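/- **Setting.** Let $A$ be a self-adjoint operator on a complex Hilbert space $H$ with domain $D(A)$, with powers $A^0=I$, $D(A^{n+1})=\{x\in D(A^n): A^nx\in D(A)\}$, and let $N$ be a positive integer. Let $J:H\to H$ be a (nonlinear) mapping with $J(D(A^j))\subset D(A^j)$ for $0\le j\le N$ such that, for every $0\le j\le N$ and all $u,v\in D(A^N)$, 1. $\|A^jJ(u)\|\le C(\|u\|,\dots,\|A^ju\|)\,\|A^ju\|$, 2. $\|A^j(J(u)-J(v))\|\le C(\|u\|,\|v\|,\dots,\|A^ju\|,\|A^jv\|)\,\|A^j(u-v)\|$, where each $C(\cdot)$ (which may depend on $j$ and on the estimate) is a finite function, monotonically increasing in the indicated norms. Suppose in addition that $J$ has the following property for every $0\le j\le N-1$ and every $T>0$: if $\varphi:[0,T)\to D(A^N)$ is $j$ times continuously differentiable in $H$, with $\varphi^{(k)}(t)\in D(A^{N-k})$ and $t\mapsto A^{N-k}\varphi^{(k)}(t)$ continuous on $[0,T)$ for all $k\le j$, then $t\mapsto J(\varphi(t))$ is $j$ times continuously differentiable on $[0,T)$, $(\frac{d}{dt})^jJ(\varphi(t))\in D(A^{N-j-1})$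 for all $t\in[0,T)$, and $t\mapsto A^{N-j-1}(\frac{d}{dt})^jJ(\varphi(t))$ is continuous. Let $\Theta:E\to\mathbb C$ be a function on a complex vector space $E$, and fix $\zeta,\eta\in E$ and $z\in\mathbb C$. For $\varphi_0\in D(A^N)$ and $T>0$, a *strong solution on $[0,T)$* is a function $\varphi:[0,T)\to D(A^N)$ with $\varphi(0)=\varphi_0$ that is strongly differentiable in $H$ on $[0,T)$ (one-sidedly at $0$) and satisfies $$\varphi'(t)=-iA\varphi(t)+J(\varphi(t))+\Theta(\zeta+z\eta)\,\varphi(t),\qquad t\in[0,T).$$ **Theorem.** For every $\varphi_0\in D(A^N)$ there is a $T>0$ for which a strong solution on $[0,T)$ exists. Moreover, for every $T>0$, a strong solution $\varphi$ on $[0,T)$ is unique, it is $N$ times strongly continuously differentiable on $[0,T)$ as an $H$-valued function, and $\varphi^{(j)}(t)\in D(A^{N-j})$ for all $0\le j\le N$ and $t\in[0,T)$. (All derivatives at $t=0$ are one-sided.) -/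

import Mathlib

open Set

namespace SemilinearEvolution

variable {H : Type*} [NormedAddCommGroup H] [InnerProductSpace ℂ H]

/-- The power `A ^ n` of an unbounded operator, with its natural domain:
`D(A ^ 0) = H` and `D(A ^ (n + 1)) = {x ∈ D(A ^ n) | A ^ n x ∈ D(A)}`. -/
def opPow (A : H →ₗ.[ℂ] H) : ℕ → (H →ₗ.[ℂ] H)
  | 0 => LinearMap.id.toPMap ⊤
  | n + 1 =>
    { domain := (A.domain.comap (opPow A n).toFun).map (opPow A n).domain.subtype
      toFun :=
        { toFun := fun x =>
            A ⟨opPow A n ⟨x, by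
                obtain ⟨y, -, hy⟩ := x.2
                exact hy ▸ y.2⟩, by
              obtain ⟨y, hy, hyx⟩ := x.2
              have h : (⟨x, hyx ▸ y.2⟩ : (opPow A n).domain) = y := Subtype.ext hyx.symm
              rw [h]
              exact hy⟩
          map_add' := fun x y => by
            rw [← LinearPMap.map_add]
            congr 1
            apply Subtype.ext
            exact LinearPMap.map_add (opPow A n) ⟨x, _⟩ ⟨y, _⟩
          map_smul' := fun c x => by
            rw [RingHom.id_apply, ← LinearPMap.map_smul]
            congr 1
            apply Subtype.ext
            exact LinearPMap.map_smul (opPow A n) c ⟨x, _⟩ } }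

/-- The domain `D(A ^ n)`, as a subspace of `H`. -/
def domPow (A : H →ₗ.[ℂ] H) (n : ℕ) : Submodule ℂ H := (opPow A n).domain

open Classical in
/-- The vector `A ^ n x` for `x ∈ D(A ^ n)` (and `0` for other `x`; it is only used together with
the membership `x ∈ D(A ^ n)`). -/
noncomputable def powVal (A : H →ₗ.[ℂ] H) (n : ℕ) (x : H) : H :=
  if h : x ∈ domPow A n then opPow A n ⟨x, h⟩ else 0

/-- The vector of norms `(‖x‖, ‖A x‖, …, ‖A ^ j x‖)`. -/
noncomputable def normVec (A : H →ₗ.[ℂ] H) (j : ℕ) (x : H) : Fin (j + 1) → ℝ :=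
  fun i => ‖powVal A i x‖

/-- The standing hypothesis on the nonlinearity: `J` maps `D(A ^ j)` into `D(A ^ j)` for
`0 ≤ j ≤ N`, and on `D(A ^ N)` it satisfies, for each such `j`, the growth and Lipschitz estimates
in `‖A ^ j ·‖`, with constants that are finite increasing functions of the lower norms. -/
structure NonlinearityHyp (A : H →ₗ.[ℂ] H) (N : ℕ) (J : H → H) : Prop where
  mapsTo : ∀ j ≤ N, ∀ u ∈ domPow A j, J u ∈ domPow A j
  growth : ∀ j ≤ N, ∃ C : (Fin (j + 1) → ℝ) → ℝ, MonotoneOn C (Ici 0) ∧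
    ∀ u ∈ domPow A N, ‖powVal A j (J u)‖ ≤ C (normVec A j u) * ‖powVal A j u‖
  lipschitz : ∀ j ≤ N, ∃ C : (Fin (j + 1) → ℝ) × (Fin (j + 1) → ℝ) → ℝ, MonotoneOn C (Ici 0) ∧
    ∀ u ∈ domPow A N, ∀ v ∈ domPow A N,
      ‖powVal A j (J u - J v)‖ ≤ C (normVec A j u, normVec A j v) * ‖powVal A j (u - v)‖

/-- `J` preserves differentiability of curves: if a `D(A ^ N)`-valued curve `φ` on `[0, T)` is `j`
times continuously differentiable, its derivatives satisfy `φ⁽ᵏ⁾(t) ∈ D(A ^ (N - k))`, and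
`A ^ (N - k) φ⁽ᵏ⁾` is continuous for all `k ≤ j`, then `J ∘ φ` is `j` times continuously
differentiable, its `j`-th derivative lies in `D(A ^ (N - j - 1))`, and `A ^ (N - j - 1)` of it is
continuous. Here `j` runs through `0, …, N - 1`. -/
def PreservesDifferentiability (A : H →ₗ.[ℂ] H) (N : ℕ) (J : H → H) : Prop :=
  ∀ j < N, ∀ T > (0 : ℝ), ∀ φ : ℝ → H,
    (∀ t ∈ Ico 0 T, φ t ∈ domPow A N) →
    ContDiffOn ℝ j φ (Ico 0 T) →
    (∀ k ≤ j, (∀ t ∈ Ico 0 T, iteratedDerivWithin k φ (Ico 0 T) t ∈ domPow A (N - k)) ∧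
      ContinuousOn (fun t => powVal A (N - k) (iteratedDerivWithin k φ (Ico 0 T) t))
        (Ico 0 T)) →
    ContDiffOn ℝ j (fun t => J (φ t)) (Ico 0 T) ∧
    (∀ t ∈ Ico 0 T,
      iteratedDerivWithin j (fun s => J (φ s)) (Ico 0 T) t ∈ domPow A (N - j - 1)) ∧
    ContinuousOn (fun t => powVal A (N - j - 1)
      (iteratedDerivWithin j (fun s => J (φ s)) (Ico 0 T) t)) (Ico 0 T)

/-- `φ` is a `D(A ^ N)`-valued strong solution on `[0, T)` of
`φ' = -i A φ + J(φ) + θ φ`, `φ(0) = φ₀` (the derivative at `0` is one-sided). -/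
structure IsStrongSolution (A : H →ₗ.[ℂ] H) (N : ℕ) (J : H → H) (θ : ℂ) (φ₀ : H) (T : ℝ)
    (φ : ℝ → H) : Prop where
  mem : ∀ t ∈ Ico 0 T, φ t ∈ domPow A N
  init : φ 0 = φ₀
  hasDeriv : ∀ t ∈ Ico 0 T,
    HasDerivWithinAt φ (-(Complex.I • powVal A 1 (φ t)) + J (φ t) + θ • φ t) (Ico 0 T) t

end SemilinearEvolution

namespace SemilinearEvolution

open Filter Topology Metric
open scoped NNReal

variable {H : Type*} [NormedAddCommGroup H] [InnerProductSpace ℂ H]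

local notation "⟪" x ", " y "⟫" => inner ℂ x y

/-! The unbounded operator is traded for its bounded resolvent `R = (A - i)⁻¹`. The range of `R ^ n`
is `D(A ^ n)`, `R ^ n` is injective, and `A ^ n R ^ n = (1 + i R) ^ n`; so `u = R ^ N y`
parametrises `D(A ^ N)` by `y ∈ H`. The group `U t = exp (-i t A)` comes from the continuous
functional calculus of the normal operator `R`.

Existence: in the coordinate `y` the nonlinearity becomes a locally Lipschitz map of `H`
(`NonlinearityHyp.exists_lift`). Passing to `ψ t = U (-t) (y t)` removes `A` from the equation, and
Picard–Lindelöf applies (`IsUnitaryGroup.exists_local_mild`).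

Uniqueness: for `U (-t) (φ t)` the Lipschitz estimate with `j = 0` suffices
(`NonlinearityHyp.eqOn_of_solvesOn`).

Regularity: a strong solution is only assumed differentiable in `H`, whereas the differentiability
property of `J` asks for continuity of `A ^ N φ`. Comparison with the local solutions constructed
above, started at each time, supplies it (`NonlinearityHyp.exists_continuousOn_of_solvesOn`). Then
`PreservesDifferentiability.regularity` bootstraps: each derivative in time costs one power of `A`.
-/

/-- `R = (A - c)⁻¹` as an everywhere defined bounded operator. -/
structure IsResolventAt (A : H →ₗ.[ℂ] H) (c : ℂ) (R : H →L[ℂ] H) : Prop where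
  mem : ∀ y, R y ∈ A.domain
  apply_eq : ∀ y, A ⟨R y, mem y⟩ = y + c • R y
  left_inv : ∀ x : A.domain, R (A x - c • (x : H)) = x

/-! ### Resolvent of a self-adjoint operator -/

section Resolvent

variable [CompleteSpace H] {A : H →ₗ.[ℂ] H}

theorem inner_apply_eq_of_isSelfAdjoint (hA : IsSelfAdjoint A) (x y : A.domain) :
    ⟪A x, (y : H)⟫ = ⟪(x : H), A y⟫ := by
  have h := LinearPMap.adjoint_isFormalAdjoint hA.dense_domain
  rw [LinearPMap.isSelfAdjoint_def.1 hA] at h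
  exact h x y

theorem exists_apply_eq_of_forall_inner (hA : IsSelfAdjoint A) {y w : H}
    (h : ∀ x : A.domain, ⟪w, (x : H)⟫ = ⟪y, A x⟫) : ∃ hy : y ∈ A.domain, A ⟨y, hy⟩ = w := by
  have key : ∃ hy : y ∈ A.adjoint.domain, A.adjoint ⟨y, hy⟩ = w :=
    ⟨LinearPMap.mem_adjoint_domain_of_exists y ⟨w, h⟩,
      LinearPMap.adjoint_apply_eq hA.dense_domain _ h⟩
  rwa [LinearPMap.isSelfAdjoint_def.1 hA] at key

/-- Since `⟪x, A x⟫` is real, the imaginary part of `⟪x, (A - c) x⟫` is `-Im c ‖x‖²`; Cauchy–Schwarz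
finishes. -/
theorem abs_im_mul_norm_le (hA : IsSelfAdjoint A) (c : ℂ) (x : A.domain) :
    |c.im| * ‖(x : H)‖ ≤ ‖A x - c • (x : H)‖ := by
  have hre : (⟪(x : H), A x⟫).im = 0 := by
    have h1 : (starRingEnd ℂ) ⟪(x : H), A x⟫ = ⟪(x : H), A x⟫ := by
      rw [inner_conj_symm, inner_apply_eq_of_isSelfAdjoint hA]
    exact Complex.conj_eq_iff_im.1 h1
  have him : (⟪(x : H), A x - c • (x : H)⟫).im = -(c.im * (‖(x : H)‖ * ‖(x : H)‖)) := by
    have hs : ⟪(x : H), (x : H)⟫ = ((‖(x : H)‖ * ‖(x : H)‖ : ℝ) : ℂ) := by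
      rw [inner_self_eq_norm_sq_to_K, ← sq]
      push_cast
      rfl
    rw [inner_sub_right, inner_smul_right, hs, Complex.sub_im, hre, Complex.im_mul_ofReal]
    ring
  have h2 : |c.im| * ‖(x : H)‖ * ‖(x : H)‖ ≤ ‖A x - c • (x : H)‖ * ‖(x : H)‖ := by
    have h3 := (Complex.abs_im_le_norm _).trans (norm_inner_le_norm (𝕜 := ℂ) (x : H)
      (A x - c • (x : H)))
    rw [him, abs_neg, abs_mul, abs_of_nonneg (by positivity : 0 ≤ ‖(x : H)‖ * ‖(x : H)‖)] at h3
    linarith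
  rcases (norm_nonneg (x : H)).eq_or_lt with h0 | h0
  · rw [← h0, mul_zero]; exact norm_nonneg _
  · exact le_of_mul_le_mul_right h2 h0

/-- On the closed graph of `A`, `A - c` is a bounded operator that is bounded below, hence injective
with closed range. A vector orthogonal to the range is an eigenvector of `A` for `conj c` or zero,
and the lower bound at `conj c` leaves only zero. -/
theorem exists_isResolventAt (hA : IsSelfAdjoint A) {c : ℂ} (hc : c.im ≠ 0) :
    ∃ R : H →L[ℂ] H, IsResolventAt A c R := by
  have hcl : IsClosed (A.graph : Set (H × H)) := hA.isClosed
  have : CompleteSpace A.graph := hcl.completeSpace_coe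
  have hpos : 0 < |c.im| := abs_pos.2 hc
  let T : A.graph →L[ℂ] H :=
    (ContinuousLinearMap.snd ℂ H H - c • ContinuousLinearMap.fst ℂ H H) ∘L A.graph.subtypeL
  have hT : ∀ p : A.graph, T p = (p : H × H).2 - c • (p : H × H).1 := fun p => rfl
  have hgr : ∀ p : A.graph, ∃ h : (p : H × H).1 ∈ A.domain, A ⟨_, h⟩ = (p : H × H).2 := by
    intro p
    obtain ⟨y, hy1, hy2⟩ := (LinearPMap.mem_graph_iff A).1 p.2
    exact ⟨hy1 ▸ y.2, by rw [← hy2]; congr 1; exact Subtype.ext hy1.symm⟩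
  have hb1 : ∀ p : A.graph, ‖(p : H × H).1‖ ≤ |c.im|⁻¹ * ‖T p‖ := by
    intro p
    obtain ⟨h1, h2⟩ := hgr p
    have := abs_im_mul_norm_le hA c ⟨_, h1⟩
    rw [h2] at this
    rw [hT, inv_mul_eq_div, le_div_iff₀ hpos, mul_comm]
    exact this
  have hb : ∀ p : A.graph, ‖p‖ ≤ (1 + |c.im|⁻¹ + ‖c‖ * |c.im|⁻¹) * ‖T p‖ := by
    intro p
    have h1 := hb1 p
    have h2 : ‖(p : H × H).2‖ ≤ ‖T p‖ + ‖c‖ * ‖(p : H × H).1‖ := by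
      have : (p : H × H).2 = T p + c • (p : H × H).1 := by rw [hT]; abel
      calc _ = ‖T p + c • (p : H × H).1‖ := by rw [← this]
        _ ≤ _ := (norm_add_le _ _).trans (by rw [norm_smul])
    have h3 : ‖c‖ * ‖(p : H × H).1‖ ≤ ‖c‖ * (|c.im|⁻¹ * ‖T p‖) := by gcongr
    have h4 : 0 ≤ ‖c‖ * (|c.im|⁻¹ * ‖T p‖) := by positivity
    have h5 : 0 ≤ |c.im|⁻¹ * ‖T p‖ := by positivity
    change max ‖(p : H × H).1‖ ‖(p : H × H).2‖ ≤ _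
    refine max_le ?_ ?_ <;> nlinarith [norm_nonneg (T p)]
  have hanti : AntilipschitzWith (Real.toNNReal (1 + |c.im|⁻¹ + ‖c‖ * |c.im|⁻¹)) T := by
    refine AddMonoidHomClass.antilipschitz_of_bound T fun p => ?_
    rw [Real.coe_toNNReal _ (by positivity)]
    exact hb p
  have hclR : IsClosed (Set.range T) := hanti.isClosed_range T.uniformContinuous
  have hrange : LinearMap.range T.toLinearMap = ⊤ := by
    have : CompleteSpace (LinearMap.range T.toLinearMap) := by
      apply IsClosed.completeSpace_coe (hs := ?_)
      exact hclR
    rw [← Submodule.orthogonal_eq_bot_iff, Submodule.eq_bot_iff]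
    intro y hy
    have hort : ∀ x : A.domain, ⟪y, A x - c • (x : H)⟫ = 0 := by
      intro x
      exact (Submodule.mem_orthogonal' _ y).1 hy _ ⟨⟨(x, A x), A.mem_graph x⟩, rfl⟩
    obtain ⟨hy1, hy2⟩ := exists_apply_eq_of_forall_inner hA (y := y)
      (w := (starRingEnd ℂ) c • y) (fun x => by
        have := hort x
        rw [inner_sub_right, inner_smul_right, sub_eq_zero] at this
        rw [this, inner_smul_left, Complex.conj_conj])
    have h3 := abs_im_mul_norm_le hA ((starRingEnd ℂ) c) ⟨y, hy1⟩
    rw [hy2, sub_self, norm_zero, Complex.conj_im, abs_neg] at h3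
    have h4 : ‖y‖ ≤ 0 := by
      by_contra h
      push Not at h
      exact absurd h3 (not_le.2 (mul_pos hpos h))
    exact norm_le_zero_iff.1 h4
  let e := ContinuousLinearEquiv.ofBijective T (LinearMap.ker_eq_bot.2 hanti.injective) hrange
  have he : ∀ y, T (e.symm y) = y := fun y => e.apply_symm_apply y
  have he' : ∀ p, e.symm (T p) = p := fun p => e.symm_apply_apply p
  refine ⟨ContinuousLinearMap.fst ℂ H H ∘L A.graph.subtypeL ∘L (e.symm : H →L[ℂ] A.graph),
    ⟨fun y => (hgr (e.symm y)).1, fun y => ?_, fun x => ?_⟩⟩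
  · refine (hgr (e.symm y)).2.trans ?_
    have := he y
    rw [hT, sub_eq_iff_eq_add] at this
    exact this
  · have := he' ⟨(x, A x), A.mem_graph x⟩
    exact congrArg (fun p : A.graph => (p : H × H).1) this

variable {R : H →L[ℂ] H}

omit [CompleteSpace H] in
theorem IsResolventAt.injective {c : ℂ} (hR : IsResolventAt A c R) : Function.Injective R := by
  refine (injective_iff_map_eq_zero R).2 fun y hy => ?_
  have h : (⟨R y, hR.mem y⟩ : A.domain) = 0 := Subtype.ext hy
  have h1 := hR.apply_eq y
  rw [h, LinearPMap.map_zero, hy, smul_zero, add_zero] at h1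
  exact h1.symm

omit [CompleteSpace H] in
theorem IsResolventAt.mem_domain_iff {c : ℂ} (hR : IsResolventAt A c R) (x : H) :
    x ∈ A.domain ↔ ∃ y, R y = x :=
  ⟨fun h => ⟨_, hR.left_inv ⟨x, h⟩⟩, fun ⟨y, hy⟩ => hy ▸ hR.mem y⟩

theorem IsResolventAt.denseRange {c : ℂ} (hR : IsResolventAt A c R) (hA : IsSelfAdjoint A) :
    DenseRange R := by
  refine hA.dense_domain.mono fun x hx => ?_
  exact (hR.mem_domain_iff x).1 hx

-- The first resolvent identity, from applying `R` to `(A - c) R' y = y + (d - c) R' y`.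
omit [CompleteSpace H] in
theorem IsResolventAt.sub_eq_smul_mul {c d : ℂ} {R' : H →L[ℂ] H} (hR : IsResolventAt A c R)
    (hR' : IsResolventAt A d R') : R' - R = (d - c) • (R * R') := by
  ext y
  have h1 := hR.left_inv ⟨R' y, hR'.mem y⟩
  rw [hR'.apply_eq] at h1
  simp only [map_sub, map_add, map_smul] at h1
  change R' y - R y = (d - c) • R (R' y)
  rw [sub_smul]
  nth_rewrite 1 [← h1]
  abel

theorem IsResolventAt.star_eq (hA : IsSelfAdjoint A) {c : ℂ} {R' : H →L[ℂ] H}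
    (hR : IsResolventAt A c R) (hR' : IsResolventAt A ((starRingEnd ℂ) c) R') : star R = R' := by
  rw [ContinuousLinearMap.star_eq_adjoint]
  symm
  rw [ContinuousLinearMap.eq_adjoint_iff]
  intro x y
  have h := inner_apply_eq_of_isSelfAdjoint hA ⟨_, hR'.mem x⟩ ⟨_, hR.mem y⟩
  rw [hR'.apply_eq, hR.apply_eq] at h
  simp only [inner_add_left, inner_add_right, inner_smul_left, inner_smul_right,
    Complex.conj_conj] at h
  exact (add_right_cancel h).symm

/-- The resolvent identity for the pair `c`, `conj c`, read in both orders, shows that `R` commutes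
with its adjoint. -/
theorem IsResolventAt.isStarNormal (hA : IsSelfAdjoint A) {c : ℂ} (hc : c.im ≠ 0)
    (hR : IsResolventAt A c R) : IsStarNormal R := by
  obtain ⟨R', hR'⟩ := exists_isResolventAt hA (c := (starRingEnd ℂ) c) (by simpa using hc)
  refine ⟨?_⟩
  rw [hR.star_eq hA hR']
  have h1 := hR.sub_eq_smul_mul hR'
  have h2 := hR'.sub_eq_smul_mul hR
  have hne : (starRingEnd ℂ) c - c ≠ 0 := by
    intro h
    exact hc (Complex.conj_eq_iff_im.1 (sub_eq_zero.1 h))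
  have h3 : ((starRingEnd ℂ) c - c) • (R' * R) = ((starRingEnd ℂ) c - c) • (R * R') := by
    rw [← h1, ← neg_sub c, neg_smul, ← h2, neg_sub]
  exact smul_right_injective _ hne h3

theorem IsResolventAt.sub_star_eq (hA : IsSelfAdjoint A) {c : ℂ} (hc : c.im ≠ 0)
    (hR : IsResolventAt A c R) : star R - R = ((starRingEnd ℂ) c - c) • (R * star R) := by
  obtain ⟨R', hR'⟩ := exists_isResolventAt hA (c := (starRingEnd ℂ) c) (by simpa using hc)
  rw [hR.star_eq hA hR']
  exact hR.sub_eq_smul_mul hR'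

end Resolvent

/-! ### Domains of powers as ranges of `R ^ n` -/

section Powers

variable {A : H →ₗ.[ℂ] H} {R : H →L[ℂ] H}

theorem powVal_of_mem {n : ℕ} {x : H} (h : x ∈ domPow A n) : powVal A n x = opPow A n ⟨x, h⟩ :=
  dif_pos h

theorem mem_domPow_zero (x : H) : x ∈ domPow A 0 := Submodule.mem_top

theorem powVal_zero (x : H) : powVal A 0 x = x := powVal_of_mem (mem_domPow_zero x)

theorem mem_domPow_succ {n : ℕ} {x : H} :
    x ∈ domPow A (n + 1) ↔ x ∈ domPow A n ∧ powVal A n x ∈ A.domain := by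
  constructor
  · rintro ⟨y, hy, rfl⟩
    have h1 : (opPow A n).domain.subtype y ∈ domPow A n := y.2
    refine ⟨h1, ?_⟩
    rw [powVal_of_mem h1]
    exact hy
  · rintro ⟨h1, h2⟩
    rw [powVal_of_mem h1] at h2
    exact ⟨⟨x, h1⟩, h2, rfl⟩

theorem powVal_succ {n : ℕ} {x : H} (h : x ∈ domPow A (n + 1)) :
    powVal A (n + 1) x = A ⟨powVal A n x, (mem_domPow_succ.1 h).2⟩ := by
  rw [powVal_of_mem h]
  change A _ = A _
  congr 1
  apply Subtype.ext
  exact (powVal_of_mem (mem_domPow_succ.1 h).1).symm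

/-- The operator `1 + i R`, equal to `A R` when `R = (A - i)⁻¹`. -/
noncomputable def shift (R : H →L[ℂ] H) : H →L[ℂ] H := 1 + Complex.I • R

theorem shift_apply (R : H →L[ℂ] H) (y : H) : shift R y = y + Complex.I • R y := rfl

theorem commute_shift (R : H →L[ℂ] H) : Commute R (shift R) :=
  (Commute.one_right R).add_right ((Commute.refl R).smul_right _)

theorem IsResolventAt.apply_eq_shift (hR : IsResolventAt A Complex.I R) (y : H) :
    A ⟨R y, hR.mem y⟩ = shift R y := hR.apply_eq y

/-- `R ^ m` and `(1 + i R) ^ n` generate the unit ideal of the algebra generated by `R`. -/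
theorem exists_mul_pow_add_mul_shift_pow (R : H →L[ℂ] H) (m n : ℕ) :
    ∃ P Q : H →L[ℂ] H, Commute R P ∧ Commute R Q ∧ P * R ^ m + Q * shift R ^ n = 1 := by
  have h : IsCoprime (Polynomial.X : Polynomial ℂ)
      (1 + Polynomial.C Complex.I * Polynomial.X) :=
    ⟨-Polynomial.C Complex.I, 1, by ring⟩
  obtain ⟨p, q, hpq⟩ := h.pow (m := m) (n := n)
  have hc : ∀ r : Polynomial ℂ, Commute R (Polynomial.aeval R r) := fun r => by
    have := Polynomial.aeval_X (R := ℂ) R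
    nth_rewrite 1 [← this]
    exact (Commute.all Polynomial.X r).map (Polynomial.aeval R)
  refine ⟨Polynomial.aeval R p, Polynomial.aeval R q, hc p, hc q, ?_⟩
  have h1 := congrArg (Polynomial.aeval R) hpq
  simp only [map_add, map_mul, map_pow, map_one, Polynomial.aeval_X, Polynomial.aeval_C] at h1
  rw [Algebra.algebraMap_eq_smul_one, smul_mul_assoc, one_mul] at h1
  exact h1

theorem IsResolventAt.pow_mem_domPow_and (hR : IsResolventAt A Complex.I R) (n : ℕ) (w : H) :
    (R ^ n) w ∈ domPow A n ∧ powVal A n ((R ^ n) w) = (shift R ^ n) w := by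
  induction n generalizing w with
  | zero => exact ⟨mem_domPow_zero _, powVal_zero _⟩
  | succ n ih =>
    have h1 : (R ^ (n + 1)) w = (R ^ n) (R w) := by rw [pow_succ]; rfl
    have h2 : powVal A n ((R ^ (n + 1)) w) = R ((shift R ^ n) w) := by
      rw [h1, (ih _).2]
      exact (DFunLike.congr_fun ((commute_shift R).pow_right n).eq w).symm
    have h3 : (R ^ (n + 1)) w ∈ domPow A (n + 1) :=
      mem_domPow_succ.2 ⟨h1 ▸ (ih _).1, h2 ▸ hR.mem _⟩
    refine ⟨h3, ?_⟩
    rw [powVal_succ h3]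
    have h4 : (⟨_, (mem_domPow_succ.1 h3).2⟩ : A.domain) = ⟨R ((shift R ^ n) w), hR.mem _⟩ :=
      Subtype.ext h2
    rw [h4, hR.apply_eq_shift, pow_succ']
    rfl

/-- In the inductive step `x = R ^ n w` and `(1 + i R) ^ n w = A ^ n x` lies in the range of `R`. As
`R` and `(1 + i R) ^ n` are coprime, `w` itself is in that range. -/
theorem IsResolventAt.mem_domPow_iff (hR : IsResolventAt A Complex.I R) {n : ℕ} {x : H} :
    x ∈ domPow A n ↔ ∃ w, (R ^ n) w = x := by
  refine ⟨fun h => ?_, fun ⟨w, hw⟩ => hw ▸ (hR.pow_mem_domPow_and n w).1⟩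
  induction n with
  | zero => exact ⟨x, rfl⟩
  | succ n ih =>
    obtain ⟨h1, h2⟩ := mem_domPow_succ.1 h
    obtain ⟨w, rfl⟩ := ih h1
    rw [(hR.pow_mem_domPow_and n w).2] at h2
    obtain ⟨v, hv⟩ := (hR.mem_domain_iff _).1 h2
    obtain ⟨P, Q, hP, hQ, hPQ⟩ := exists_mul_pow_add_mul_shift_pow R 1 n
    refine ⟨P w + Q v, ?_⟩
    have h3 : R (P w + Q v) = w := by
      have h4 : P (R w) = R (P w) := (DFunLike.congr_fun hP.eq w).symm
      have h5 : Q (R v) = R (Q v) := (DFunLike.congr_fun hQ.eq v).symm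
      have h6 : P ((R ^ 1) w) + Q ((shift R ^ n) w) = w := DFunLike.congr_fun hPQ w
      rw [pow_one, ← hv, h4, h5, ← map_add] at h6
      exact h6
    rw [pow_succ]
    change (R ^ n) (R _) = _
    rw [h3]

theorem IsResolventAt.powVal_pow (hR : IsResolventAt A Complex.I R) {k n : ℕ} (hk : k ≤ n)
    (w : H) : powVal A k ((R ^ n) w) = (shift R ^ k * R ^ (n - k)) w := by
  have h : (R ^ n) w = (R ^ k) ((R ^ (n - k)) w) := by
    rw [← Nat.add_sub_of_le hk, pow_add, Nat.add_sub_cancel_left]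
    rfl
  rw [h, (hR.pow_mem_domPow_and k _).2]
  rfl

theorem domPow_anti {m n : ℕ} (h : m ≤ n) : domPow A n ≤ domPow A m := by
  induction h with
  | refl => exact le_rfl
  | step _ ih => exact fun x hx => ih (mem_domPow_succ.1 hx).1

theorem IsResolventAt.pow_injective (hR : IsResolventAt A Complex.I R) (n : ℕ) :
    Function.Injective (R ^ n : H →L[ℂ] H) := by
  induction n with
  | zero => exact fun x y h => h
  | succ n ih =>
    rw [pow_succ]
    exact ih.comp hR.injective

end Powers

/-! ### The unitary group and its symbols -/

/-- `U` is the strongly continuous unitary group `t ↦ exp (-i t A)`, with `A` given through its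
resolvent `R = (A - i)⁻¹`. -/
structure IsUnitaryGroup (R : H →L[ℂ] H) (U : ℝ → H →L[ℂ] H) : Prop where
  zero : U 0 = 1
  add : ∀ s t, U (s + t) = U s * U t
  norm_eq : ∀ t x, ‖U t x‖ = ‖x‖
  commute : ∀ t, Commute R (U t)
  continuous : ∀ x, Continuous fun t => U t x
  hasDerivAt : ∀ y t, HasDerivAt (fun s => U s (R y)) (-(Complex.I • U t (shift R y))) t

section Phase

/-- The function `z ↦ z exp (-i t λ)` with `λ = Re z⁻¹`; for `z = (λ - i)⁻¹` it describes
`exp (-i t A) (A - i)⁻¹`. -/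
noncomputable def phaseMul (t : ℝ) (z : ℂ) : ℂ :=
  z * Complex.exp (Complex.I * ((-t * (z⁻¹).re : ℝ) : ℂ))

theorem norm_phaseMul (t : ℝ) (z : ℂ) : ‖phaseMul t z‖ = ‖z‖ := by
  rw [phaseMul, norm_mul, mul_comm Complex.I, Complex.norm_exp_ofReal_mul_I, mul_one]

/-- The phase oscillates without limit as `z → 0` (energy tending to infinity); the factor `z` damps
it. This is why the calculus is applied to `exp (-i t A) R` and not to the exponential alone. -/
theorem continuous_phaseMul (t : ℝ) : Continuous (phaseMul t) := by
  refine continuous_iff_continuousAt.2 fun z => ?_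
  by_cases hz : z = 0
  · subst hz
    have h0 : phaseMul t 0 = 0 := by simp [phaseMul]
    rw [ContinuousAt, h0, tendsto_zero_iff_norm_tendsto_zero]
    simp only [norm_phaseMul]
    exact tendsto_norm_zero
  · have h : ContinuousAt (fun w : ℂ => w⁻¹) z := continuousAt_inv₀ hz
    have h1 : ContinuousAt (fun w : ℂ => ((-t * (w⁻¹).re : ℝ) : ℂ)) z :=
      Complex.continuous_ofReal.continuousAt.comp
        (continuousAt_const.mul (Complex.continuous_re.continuousAt.comp h))
    exact continuousAt_id.mul (continuousAt_const.mul h1).cexp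

theorem phaseMul_zero (z : ℂ) : phaseMul 0 z = z := by simp [phaseMul]

theorem phaseMul_eq_mul_exp (s t : ℝ) (z : ℂ) :
    phaseMul s z = phaseMul t z * Complex.exp (Complex.I * ((-(s - t) * (z⁻¹).re : ℝ) : ℂ)) := by
  rw [phaseMul, phaseMul, mul_assoc, ← Complex.exp_add, ← mul_add, ← Complex.ofReal_add]
  congr 5
  ring

theorem phaseMul_mul (s t : ℝ) (z : ℂ) : phaseMul s z * phaseMul t z = phaseMul (s + t) z * z := by
  rw [phaseMul_eq_mul_exp (s + t) t, phaseMul]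
  simp only [add_sub_cancel_right]
  ring

theorem norm_mul_abs_re_inv_le (z : ℂ) : ‖z‖ * |(z⁻¹).re| ≤ 1 := by
  calc ‖z‖ * |(z⁻¹).re| ≤ ‖z‖ * ‖z⁻¹‖ := by gcongr; exact Complex.abs_re_le_norm _
    _ = ‖z * z⁻¹‖ := (norm_mul _ _).symm
    _ ≤ 1 := by
      by_cases hz : z = 0
      · simp [hz]
      · simp [hz]

theorem norm_phaseMul_sub_le (s t : ℝ) (z : ℂ) : ‖phaseMul s z - phaseMul t z‖ ≤ |s - t| := by
  rw [phaseMul_eq_mul_exp s t, ← mul_sub_one, norm_mul, norm_phaseMul]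
  calc _ ≤ ‖z‖ * ‖-(s - t) * (z⁻¹).re‖ := by
        gcongr; exact Real.norm_exp_I_mul_ofReal_sub_one_le
    _ = |s - t| * (‖z‖ * |(z⁻¹).re|) := by
        rw [norm_mul, norm_neg, Real.norm_eq_abs, Real.norm_eq_abs]; ring
    _ ≤ |s - t| := mul_le_of_le_one_right (abs_nonneg _) (norm_mul_abs_re_inv_le z)

theorem norm_exp_I_mul_sub_one_sub_le (x : ℝ) :
    ‖Complex.exp (Complex.I * x) - 1 - Complex.I * x‖ ≤ 3 * x ^ 2 := by
  have hx : ‖Complex.I * (x : ℂ)‖ = |x| := by simp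
  rcases le_total |x| 1 with h | h
  · refine (Complex.norm_exp_sub_one_sub_id_le (hx.le.trans h)).trans ?_
    rw [hx, sq_abs]
    nlinarith [sq_nonneg x]
  · refine (norm_sub_le _ _).trans ?_
    have h1 : ‖Complex.exp (Complex.I * x) - 1‖ ≤ |x| := Real.norm_exp_I_mul_ofReal_sub_one_le
    rw [hx]
    nlinarith [sq_abs x]

/-- Second order Taylor estimate for `t ↦ exp (-i t A) (A - i)⁻²`, on the level of symbols. -/
theorem norm_phaseMul_taylor_le (s t : ℝ) {z : ℂ}
    (hz : star z - z = (star Complex.I - Complex.I) * (z * star z)) :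
    ‖phaseMul s z * z - phaseMul t z * z
      - ((s - t : ℝ) * -Complex.I) * (phaseMul t z * (1 + Complex.I * z))‖ ≤ 3 * (s - t) ^ 2 := by
  set r : ℝ := (z⁻¹).re with hr
  -- The hypothesis on `z` says `z⁻¹ = r - i` with `r` real, so `1 + i z = z r`: the symbol of `A
  -- R`.
  have key : phaseMul t z * (1 + Complex.I * z) = phaseMul t z * z * r := by
    by_cases h0 : z = 0
    · simp [h0, phaseMul]
    · have h1 : star z ≠ 0 := star_ne_zero.2 h0
      have h2 : z⁻¹ - star z⁻¹ = -2 * Complex.I := by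
        rw [star_inv₀]
        field_simp
        rw [hz]
        simp only [Complex.star_def, Complex.conj_I]
        ring
      have h3 : (r : ℂ) = (z⁻¹ + star z⁻¹) / 2 := by
        rw [hr, Complex.re_eq_add_conj]; rfl
      have h4 : (r : ℂ) = z⁻¹ + Complex.I := by
        rw [h3]
        linear_combination (-1 / 2 : ℂ) * h2
      rw [h4]
      field_simp
  rw [key, phaseMul_eq_mul_exp s t]
  have h5 : phaseMul t z * Complex.exp (Complex.I * ((-(s - t) * r : ℝ) : ℂ)) * z
      - phaseMul t z * z - ((s - t : ℝ) * -Complex.I) * (phaseMul t z * z * r)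
      = phaseMul t z * z * (Complex.exp (Complex.I * ((-(s - t) * r : ℝ) : ℂ)) - 1
        - Complex.I * ((-(s - t) * r : ℝ) : ℂ)) := by
    push_cast
    ring
  rw [h5, norm_mul, norm_mul, norm_phaseMul]
  have h6 := norm_mul_abs_re_inv_le z
  calc _ ≤ ‖z‖ * ‖z‖ * (3 * (-(s - t) * r) ^ 2) := by
        gcongr; exact norm_exp_I_mul_sub_one_sub_le _
    _ = 3 * (s - t) ^ 2 * (‖z‖ * |r|) ^ 2 := by rw [mul_pow, mul_pow ‖z‖, sq_abs]; ring
    _ ≤ 3 * (s - t) ^ 2 * 1 := by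
        gcongr
        exact pow_le_one₀ (by positivity) h6
    _ = _ := mul_one _

end Phase

/-! ### Construction of the group by functional calculus -/

section Group

variable [CompleteSpace H] {A : H →ₗ.[ℂ] H} {R : H →L[ℂ] H}

/-- As `phaseMul t` has modulus `|z|`, the operators `V = cfc (phaseMul t) R` and `R` satisfy `V* V
= R* R`. -/
theorem norm_cfc_phaseMul_apply (hn : IsStarNormal R) (t : ℝ) (x : H) :
    ‖cfc (phaseMul t) R x‖ = ‖R x‖ := by
  have hc := continuous_phaseMul t
  have h1 : star (cfc (phaseMul t) R) * cfc (phaseMul t) R = star R * R := by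
    rw [← cfc_star, ← cfc_mul _ _ R (by fun_prop) (by fun_prop)]
    have h2 : star R * R = cfc (fun z : ℂ => star z * z) R := by
      rw [cfc_mul _ _ R, cfc_star_id (R := ℂ) R, cfc_id' ℂ R]
    rw [h2]
    refine cfc_congr fun z _ => ?_
    change star (phaseMul t z) * phaseMul t z = star z * z
    simp only [Complex.star_def, Complex.conj_mul', norm_phaseMul]
  have h3 : ∀ B : H →L[ℂ] H, ((‖B x‖ ^ 2 : ℝ) : ℂ) = inner ℂ x ((star B * B) x) := by
    intro B
    rw [ContinuousLinearMap.star_eq_adjoint]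
    change _ = inner ℂ x (ContinuousLinearMap.adjoint B (B x))
    rw [ContinuousLinearMap.adjoint_inner_right, inner_self_eq_norm_sq_to_K]
    push_cast
    rfl
  have h4 : ‖cfc (phaseMul t) R x‖ ^ 2 = ‖R x‖ ^ 2 := by
    have := (h3 (cfc (phaseMul t) R)).trans ((by rw [h1]) : _ = inner ℂ x ((star R * R) x))
    rw [← h3] at this
    exact_mod_cast this
  exact (sq_eq_sq₀ (norm_nonneg _) (norm_nonneg _)).1 h4

theorem norm_cfc_phaseMul_sub_le [IsStarNormal R] (s t : ℝ) :
    ‖cfc (phaseMul s) R - cfc (phaseMul t) R‖ ≤ |s - t| := by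
  have hs := continuous_phaseMul s
  have ht := continuous_phaseMul t
  rw [← cfc_sub (phaseMul s) (phaseMul t) R]
  exact norm_cfc_le (abs_nonneg _) fun z _ => norm_phaseMul_sub_le s t z

theorem cfc_shift [IsStarNormal R] : cfc (fun z : ℂ => 1 + Complex.I * z) R = shift R := by
  rw [cfc_add R (fun _ : ℂ => (1 : ℂ)) (fun z : ℂ => Complex.I * z), cfc_const_one ℂ R,
    cfc_const_mul_id Complex.I R]
  rfl

theorem IsResolventAt.norm_cfc_phaseMul_taylor_le (hA : IsSelfAdjoint A)
    (hR : IsResolventAt A Complex.I R) (s t : ℝ) :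
    ‖cfc (phaseMul s) R * R - cfc (phaseMul t) R * R
      - ((s - t : ℝ) * -Complex.I) • (cfc (phaseMul t) R * shift R)‖ ≤ 3 * (s - t) ^ 2 := by
  have hn := hR.isStarNormal hA (by simp)
  have hs := continuous_phaseMul s
  have ht := continuous_phaseMul t
  -- The operator identity for `star R - R` becomes a pointwise identity on the spectrum, since the
  -- calculus is faithful there.
  have hspec : ∀ z ∈ spectrum ℂ R, star z - z = (star Complex.I - Complex.I) * (z * star z) := by
    have h1 := hR.sub_star_eq hA (by simp)
    have h2 : cfc (fun z : ℂ => star z - z) R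
        = cfc (fun z : ℂ => (star Complex.I - Complex.I) * (z * star z)) R := by
      rw [cfc_sub (fun z : ℂ => star z) (fun z => z) R, cfc_star_id (R := ℂ) R, cfc_id' ℂ R,
        cfc_const_mul _ (fun z : ℂ => z * star z) R, cfc_mul (fun z : ℂ => z) (fun z => star z) R,
        cfc_star_id (R := ℂ) R, cfc_id' ℂ R, h1]
      rfl
    exact (cfc_eq_cfc_iff_eqOn (R := ℂ)).1 h2
  have h3 : ∀ u, Continuous (phaseMul u) → cfc (fun z => phaseMul u z * z) R
      = cfc (phaseMul u) R * R := by
    intro u hu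
    rw [cfc_mul _ _ R, cfc_id' ℂ R]
  have h4 : cfc (fun z => ((s - t : ℝ) * -Complex.I) * (phaseMul t z * (1 + Complex.I * z))) R
      = ((s - t : ℝ) * -Complex.I) • (cfc (phaseMul t) R * shift R) := by
    rw [cfc_const_mul _ (fun z => phaseMul t z * (1 + Complex.I * z)) R,
      cfc_mul (phaseMul t) (fun z => 1 + Complex.I * z) R, cfc_shift]
  rw [← h3 s hs, ← h3 t ht, ← h4, ← cfc_sub (fun z => phaseMul s z * z) _ R,
    ← cfc_sub (fun z => phaseMul s z * z - phaseMul t z * z) _ R]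
  exact norm_cfc_le (by positivity) fun z hz => norm_phaseMul_taylor_le s t (hspec z hz)

/-- The quadratic Taylor bound covers `y` in the dense range of `R`. The Lipschitz bound in `t`
carries the derivative over to all `y`. -/
theorem IsResolventAt.hasDerivAt_cfc_phaseMul (hA : IsSelfAdjoint A)
    (hR : IsResolventAt A Complex.I R) (y : H) (t : ℝ) {U : H →L[ℂ] H}
    (hU : ∀ x, U (R x) = cfc (phaseMul t) R x) (hUn : ∀ x, ‖U x‖ = ‖x‖) :
    HasDerivAt (fun s => cfc (phaseMul s) R y) (-(Complex.I • U (shift R y))) t := by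
  have hn := hR.isStarNormal hA (by simp)
  rw [hasDerivAt_iff_isLittleO, Asymptotics.isLittleO_iff]
  intro ε hε
  -- Chosen so that replacing `y` by `R w` costs at most `ε / 2` in the difference quotient and the
  -- derivative together.
  set K : ℝ := 2 + ‖shift R‖ with hK
  have hKpos : 0 < K := by positivity
  obtain ⟨w, hw⟩ := (hR.denseRange hA).exists_dist_lt y (ε := ε / (2 * K)) (by positivity)
  rw [dist_eq_norm] at hw
  have hnear : ∀ᶠ s in 𝓝 t, 3 * ‖w‖ * |s - t| < ε / 2 := by
    have h : Continuous fun s : ℝ => 3 * ‖w‖ * |s - t| := by fun_prop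
    exact h.continuousAt.eventually_lt_const (by simpa using hε)
  filter_upwards [hnear] with s hs
  set V : ℝ → H →L[ℂ] H := fun u => cfc (phaseMul u) R with hV
  have hcomm : shift R (R w) = R (shift R w) := DFunLike.congr_fun (commute_shift R).eq.symm w
  have e : V s y - V t y - (s - t) • -(Complex.I • U (shift R y))
      = (V s - V t) (y - R w) - (s - t) • -(Complex.I • U (shift R (y - R w)))
        + (V s * R - V t * R - ((s - t : ℝ) * -Complex.I) • (V t * shift R)) w := by
    have h1 : U (shift R (R w)) = V t (shift R w) := by rw [hcomm, hU]
    have h2 : (V s * R - V t * R - ((s - t : ℝ) * -Complex.I) • (V t * shift R)) w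
        = V s (R w) - V t (R w) - ((s - t : ℝ) * -Complex.I) • V t (shift R w) := rfl
    have h3 : ((s - t : ℝ) * -Complex.I) • V t (shift R w)
        = (s - t) • -(Complex.I • V t (shift R w)) := by
      rw [mul_smul, neg_smul]; rfl
    have h4 : (V s - V t) (y - R w) = V s y - V s (R w) - (V t y - V t (R w)) := by
      rw [map_sub]; simp only [sub_apply]; abel
    rw [h2, h3, h4, map_sub, map_sub, h1]
    simp only [smul_sub, smul_neg]
    abel
  have b1 : ‖(V s - V t) (y - R w)‖ ≤ |s - t| * (ε / (2 * K)) :=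
    (ContinuousLinearMap.le_opNorm _ _).trans
      (mul_le_mul (norm_cfc_phaseMul_sub_le s t) hw.le (norm_nonneg _) (abs_nonneg _))
  have b2 : ‖(s - t) • -(Complex.I • U (shift R (y - R w)))‖
      ≤ |s - t| * (‖shift R‖ * (ε / (2 * K))) := by
    rw [norm_smul, norm_neg, norm_smul, Complex.norm_I, one_mul, hUn, Real.norm_eq_abs]
    gcongr
    exact (ContinuousLinearMap.le_opNorm _ _).trans (by gcongr)
  have b3 : ‖(V s * R - V t * R - ((s - t : ℝ) * -Complex.I) • (V t * shift R)) w‖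
      ≤ 3 * (s - t) ^ 2 * ‖w‖ :=
    (ContinuousLinearMap.le_opNorm _ _).trans
      (by gcongr; exact hR.norm_cfc_phaseMul_taylor_le hA s t)
  have b4 : 3 * (s - t) ^ 2 * ‖w‖ ≤ |s - t| * (ε / 2) := by
    rw [← sq_abs]
    nlinarith [abs_nonneg (s - t), hs.le]
  have b5 : (1 + ‖shift R‖) * (ε / (2 * K)) ≤ ε / 2 := by
    rw [show ε / 2 = K * (ε / (2 * K)) by field_simp]
    have : 0 < ε / (2 * K) := by positivity
    gcongr
    rw [hK]; linarith
  rw [e]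
  calc _ ≤ |s - t| * (ε / (2 * K)) + |s - t| * (‖shift R‖ * (ε / (2 * K)))
        + |s - t| * (ε / 2) :=
        (norm_add_le _ _).trans
          (add_le_add ((norm_sub_le _ _).trans (add_le_add b1 b2)) (b3.trans b4))
    _ = |s - t| * ((1 + ‖shift R‖) * (ε / (2 * K)) + ε / 2) := by ring
    _ ≤ |s - t| * (ε / 2 + ε / 2) := by gcongr
    _ = ε * ‖s - t‖ := by rw [Real.norm_eq_abs]; ring

/-- The map `R x ↦ V t x` is isometric on a dense subspace, hence extends to `U t`. -/
theorem IsResolventAt.exists_isUnitaryGroup (hA : IsSelfAdjoint A)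
    (hR : IsResolventAt A Complex.I R) : ∃ U : ℝ → H →L[ℂ] H, IsUnitaryGroup R U := by
  have hn := hR.isStarNormal hA (by simp)
  have hd := hR.denseRange hA
  set V : ℝ → H →L[ℂ] H := fun t => cfc (phaseMul t) R with hV
  have hVn : ∀ t x, ‖V t x‖ = ‖R x‖ := fun t x => norm_cfc_phaseMul_apply hn t x
  let U : ℝ → H →L[ℂ] H := fun t => (V t).toLinearMap.extendOfNorm R.toLinearMap
  have hU : ∀ t x, U t (R x) = V t x := fun t x =>
    LinearMap.extendOfNorm_eq (f := (V t).toLinearMap) (e := R.toLinearMap) hd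
      ⟨1, fun x => by rw [one_mul]; exact (hVn t x).le⟩ x
  have hUn : ∀ t x, ‖U t x‖ = ‖x‖ := fun t x =>
    hd.induction_on (p := fun x => ‖U t x‖ = ‖x‖) x (isClosed_eq (by fun_prop) (by fun_prop))
      fun y => by rw [hU, hVn]
  have ext' : ∀ B C : H →L[ℂ] H, (∀ x, B (R x) = C (R x)) → B = C := fun B C h =>
    DFunLike.coe_injective (hd.equalizer B.continuous C.continuous (funext h))
  have hVR : ∀ t, R * V t = V t * R := fun t => by
    have h := cfc_commute_cfc (fun z : ℂ => z) (phaseMul t) R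
    rw [cfc_id' ℂ R] at h
    exact h.eq
  have hcomm : ∀ t, R * U t = U t * R := fun t => ext' _ _ fun x => by
    change R (U t (R x)) = U t (R (R x))
    rw [hU, hU]
    exact DFunLike.congr_fun (hVR t) x
  refine ⟨U, ⟨?_, fun s t => ?_, hUn, hcomm, fun x => ?_, fun y t => ?_⟩⟩
  · refine ext' _ _ fun x => ?_
    rw [hU]
    have : V 0 = R := by
      rw [hV]
      change cfc (phaseMul 0) R = R
      rw [show phaseMul 0 = fun z => z from funext phaseMul_zero, cfc_id' ℂ R]
    rw [this]; rfl
  · have hs := continuous_phaseMul s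
    have ht := continuous_phaseMul t
    have hst := continuous_phaseMul (s + t)
    have hmul : V s * V t = V (s + t) * R := by
      change cfc (phaseMul s) R * cfc (phaseMul t) R = cfc (phaseMul (s + t)) R * R
      have h1 : cfc (phaseMul (s + t)) R * R = cfc (fun z => phaseMul (s + t) z * z) R := by
        rw [cfc_mul _ _ R, cfc_id' ℂ R]
      rw [h1, ← cfc_mul _ _ R]
      exact cfc_congr fun z _ => phaseMul_mul s t z
    refine ext' _ _ fun x => ?_
    -- One further `R` is needed because the symbols give `V s * V t = V (s + t) * R`.
    apply hR.injective
    change R (U (s + t) (R x)) = R (U s (U t (R x)))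
    have h2 : R (U s (U t (R x))) = U s (R (V t x)) := by
      rw [hU t]; exact DFunLike.congr_fun (hcomm s) _
    rw [h2, hU, hU]
    exact (DFunLike.congr_fun ((hVR (s + t)).trans hmul.symm) x)
  · rw [Metric.continuous_iff]
    intro t ε hε
    obtain ⟨w, hw⟩ := hd.exists_dist_lt x (ε := ε / 3) (by positivity)
    rw [dist_eq_norm] at hw
    refine ⟨ε / (3 * (‖w‖ + 1)), by positivity, fun s hs => ?_⟩
    rw [Real.dist_eq] at hs
    have h1 : ‖U s (R w) - U t (R w)‖ ≤ ε / 3 := by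
      rw [hU, hU]
      calc ‖V s w - V t w‖ = ‖(V s - V t) w‖ := rfl
        _ ≤ |s - t| * ‖w‖ := (ContinuousLinearMap.le_opNorm _ _).trans
            (by gcongr; exact norm_cfc_phaseMul_sub_le s t)
        _ ≤ ε / (3 * (‖w‖ + 1)) * (‖w‖ + 1) := by gcongr; linarith
        _ = ε / 3 := by field_simp
    have h2 : U s x - U t x = U s (x - R w) + (U s (R w) - U t (R w)) - U t (x - R w) := by
      rw [map_sub, map_sub]; abel
    rw [dist_eq_norm, h2]
    calc _ ≤ ‖x - R w‖ + ε / 3 + ‖x - R w‖ := by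
          refine (norm_sub_le _ _).trans (add_le_add ((norm_add_le _ _).trans
            (add_le_add (hUn s _).le h1)) (hUn t _).le)
      _ < ε := by linarith
  · simp only [hU]
    exact hR.hasDerivAt_cfc_phaseMul hA y t (hU t) (hUn t)

end Group

/-! ### Calculus with strongly continuous isometries -/

section StrongContinuity

theorem continuousOn_apply_of_isometric {X : Type*} [TopologicalSpace X] {W : X → H →L[ℂ] H}
    (hn : ∀ t x, ‖W t x‖ = ‖x‖) (hc : ∀ x, Continuous fun t => W t x) {S : Set X} {x : X → H}
    (hx : ContinuousOn x S) : ContinuousOn (fun t => W t (x t)) S := by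
  intro t ht
  have h1 : Tendsto (fun s => W s (x s) - W s (x t)) (𝓝[S] t) (𝓝 0) := by
    rw [tendsto_zero_iff_norm_tendsto_zero]
    simp only [← map_sub, hn]
    rw [← tendsto_zero_iff_norm_tendsto_zero, ← sub_self (x t)]
    exact (hx t ht).sub tendsto_const_nhds
  have h2 := h1.add ((hc (x t)).continuousWithinAt (s := S) (x := t))
  simpa only [ContinuousWithinAt, sub_add_cancel, zero_add] using h2

/-- A product rule in which only the orbit of the frozen vector `x t` must be differentiable:
isometry controls the remainder of `x`, strong continuity the rest. -/
theorem hasDerivWithinAt_apply_of_isometric {W : ℝ → H →L[ℂ] H} (hn : ∀ t x, ‖W t x‖ = ‖x‖)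
    (hc : ∀ x, Continuous fun t => W t x) {S : Set ℝ} {t : ℝ} {x : ℝ → H} {x' d : H}
    (hx : HasDerivWithinAt x x' S t) (hW : HasDerivWithinAt (fun s => W s (x t)) d S t) :
    HasDerivWithinAt (fun s => W s (x s)) (d + W t x') S t := by
  rw [hasDerivWithinAt_iff_isLittleO] at hx hW ⊢
  have h1 : (fun s => W s (x s - x t - (s - t) • x')) =o[𝓝[S] t] fun s => s - t := by
    refine Asymptotics.IsLittleO.of_norm_left ?_
    simp only [hn]
    exact hx.norm_left
  have h2 : (fun s => (s - t) • (W s x' - W t x')) =o[𝓝[S] t] fun s => s - t := by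
    have h3 : Tendsto (fun s => W s x' - W t x') (𝓝[S] t) (𝓝 0) := by
      rw [← sub_self (W t x')]
      exact ((hc x').continuousWithinAt (s := S) (x := t)).sub tendsto_const_nhds
    have h4 := (Asymptotics.isBigO_refl (fun s : ℝ => s - t) (𝓝[S] t)).smul_isLittleO
      ((Asymptotics.isLittleO_one_iff ℝ).2 h3)
    simpa using h4
  refine ((hW.add h1).add h2).congr_left fun s => ?_
  have h5 : W s ((s - t) • x') = (s - t) • W s x' := ((W s).restrictScalars ℝ).map_smul (s - t) x'
  simp only [map_sub, h5, smul_sub, smul_add]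
  abel

end StrongContinuity

/-! ### Interaction picture -/

section Group

variable {A : H →ₗ.[ℂ] H} {R : H →L[ℂ] H} {U : ℝ → H →L[ℂ] H}

theorem IsUnitaryGroup.apply_neg_apply (hU : IsUnitaryGroup R U) (t : ℝ) (x : H) :
    U t (U (-t) x) = x := by
  change (U t * U (-t)) x = x
  rw [← hU.add, add_neg_cancel, hU.zero]; rfl

theorem IsUnitaryGroup.apply_pow (hU : IsUnitaryGroup R U) (n : ℕ) (t : ℝ) (x : H) :
    U t ((R ^ n) x) = (R ^ n) (U t x) :=
  (DFunLike.congr_fun ((hU.commute t).pow_left n).eq x).symm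

theorem IsResolventAt.exists_of_mem_domPow_one (hR : IsResolventAt A Complex.I R) {x : H}
    (hx : x ∈ domPow A 1) : ∃ w, R w = x ∧ powVal A 1 x = shift R w := by
  obtain ⟨w, rfl⟩ := hR.mem_domPow_iff.1 hx
  refine ⟨w, by rw [pow_one], ?_⟩
  rw [(hR.pow_mem_domPow_and 1 w).2, pow_one]

theorem IsUnitaryGroup.powVal_one_apply (hU : IsUnitaryGroup R U)
    (hR : IsResolventAt A Complex.I R) (t : ℝ) {x : H} (hx : x ∈ domPow A 1) :
    powVal A 1 (U t x) = U t (powVal A 1 x) := by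
  obtain ⟨w, rfl⟩ := hR.mem_domPow_iff.1 hx
  rw [hU.apply_pow, (hR.pow_mem_domPow_and 1 _).2, (hR.pow_mem_domPow_and 1 _).2, pow_one,
    shift_apply, shift_apply, map_add, map_smul]
  congr 2
  exact DFunLike.congr_fun (hU.commute t).eq w

theorem IsUnitaryGroup.hasDerivWithinAt_apply (hU : IsUnitaryGroup R U)
    (hR : IsResolventAt A Complex.I R) {S : Set ℝ} {t : ℝ} {x : ℝ → H} {x' : H}
    (hx : HasDerivWithinAt x x' S t) (hm : x t ∈ domPow A 1) :
    HasDerivWithinAt (fun s => U s (x s)) (U t (x' - Complex.I • powVal A 1 (x t))) S t := by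
  obtain ⟨w, hw, hp⟩ := hR.exists_of_mem_domPow_one hm
  have h := (hU.hasDerivAt w t).hasDerivWithinAt (s := S)
  rw [hw] at h
  refine (hasDerivWithinAt_apply_of_isometric hU.norm_eq hU.continuous hx h).congr_deriv ?_
  rw [hp, map_sub, map_smul]
  abel

theorem IsUnitaryGroup.hasDerivWithinAt_neg_apply (hU : IsUnitaryGroup R U)
    (hR : IsResolventAt A Complex.I R) {S : Set ℝ} {t : ℝ} {x : ℝ → H} {x' : H}
    (hx : HasDerivWithinAt x x' S t) (hm : x t ∈ domPow A 1) :
    HasDerivWithinAt (fun s => U (-s) (x s)) (U (-t) (x' + Complex.I • powVal A 1 (x t))) S t := by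
  obtain ⟨w, hw, hp⟩ := hR.exists_of_mem_domPow_one hm
  have h := ((hU.hasDerivAt w (-t)).scomp t (hasDerivAt_neg t)).hasDerivWithinAt (s := S)
  rw [hw] at h
  refine (hasDerivWithinAt_apply_of_isometric (W := fun s => U (-s)) (fun s => hU.norm_eq (-s))
    (fun x => (hU.continuous x).comp continuous_neg) hx h).congr_deriv ?_
  rw [hp, map_add, map_smul, neg_smul, one_smul, neg_neg]
  abel

/-- Local existence for `y' = -i A y + F y` in the interaction picture. -/
theorem IsUnitaryGroup.exists_local_mild [CompleteSpace H] (hU : IsUnitaryGroup R U) {F : H → H}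
    (hF : ∀ M : ℝ, ∃ K : ℝ≥0, LipschitzOnWith K F (closedBall 0 M)) (t₀ : ℝ) (y₀ : H) :
    ∃ δ > 0, ∃ ψ : ℝ → H, U t₀ (ψ t₀) = y₀ ∧ ∀ t ∈ Icc (t₀ - δ) (t₀ + δ),
      HasDerivWithinAt ψ (U (-t) (F (U t (ψ t)))) (Icc (t₀ - δ) (t₀ + δ)) t := by
  -- Every `U t` maps the unit ball about `U (-t₀) y₀` into the ball of radius `‖y₀‖ + 1`, so one
  -- constant serves all times.
  obtain ⟨K, hK⟩ := hF (‖y₀‖ + 1)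
  have hFc : Continuous F := by
    rw [continuous_iff_continuousAt]
    intro x
    obtain ⟨K', hK'⟩ := hF (‖x‖ + 1)
    refine hK'.continuousOn.continuousAt (closedBall_mem_nhds_of_mem ?_)
    rw [mem_ball, dist_zero_right]
    linarith
  set L : ℝ≥0 := ‖F 0‖₊ + K * (‖y₀‖₊ + 1) with hL
  have hball : ∀ t, ∀ x ∈ closedBall (U (-t₀) y₀) ((1 : ℝ≥0) : ℝ),
      U t x ∈ closedBall (0 : H) (‖y₀‖ + 1) := by
    intro t x hx
    rw [mem_closedBall, dist_eq_norm, NNReal.coe_one] at hx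
    rw [mem_closedBall, dist_zero_right, hU.norm_eq]
    have h1 : ‖x‖ ≤ ‖U (-t₀) y₀‖ + ‖x - U (-t₀) y₀‖ := norm_le_insert' _ _
    rw [hU.norm_eq] at h1
    linarith
  have h0 : (0 : H) ∈ closedBall (0 : H) (‖y₀‖ + 1) := by
    rw [mem_closedBall, dist_self]; positivity
  -- `L` bounds the field, so `L * δ ≤ 1` keeps the solution in the unit ball.
  set δ : ℝ := 1 / ((L : ℝ) + 1) with hδ
  have hδpos : 0 < δ := by positivity
  have hP : IsPicardLindelof (fun t x => U (-t) (F (U t x)))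
      (⟨t₀, by constructor <;> linarith⟩ : Icc (t₀ - δ) (t₀ + δ)) (U (-t₀) y₀) 1 0 L K := by
    refine ⟨fun t _ => ?_, fun x _ => ?_, fun t _ x hx => ?_, ?_⟩
    · refine LipschitzOnWith.of_dist_le_mul fun x hx y hy => ?_
      rw [dist_eq_norm, ← map_sub, hU.norm_eq, ← dist_eq_norm]
      refine (hK.dist_le_mul _ (hball t x hx) _ (hball t y hy)).trans (le_of_eq ?_)
      rw [dist_eq_norm, ← map_sub, hU.norm_eq, ← dist_eq_norm]
    · exact continuousOn_apply_of_isometric (W := fun s => U (-s)) (fun s => hU.norm_eq (-s))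
        (fun x => (hU.continuous x).comp continuous_neg)
        (hFc.comp (hU.continuous x)).continuousOn
    · rw [hU.norm_eq]
      have h1 := hK.dist_le_mul _ (hball t x hx) _ h0
      rw [dist_eq_norm, dist_zero_right] at h1
      have h2 := hball t x hx
      rw [mem_closedBall, dist_zero_right] at h2
      calc ‖F (U t x)‖ ≤ ‖F 0‖ + ‖F (U t x) - F 0‖ := norm_le_insert' _ _
        _ ≤ ‖F 0‖ + K * (‖y₀‖ + 1) := by gcongr; exact h1.trans (by gcongr)
        _ = L := by rw [hL]; push_cast; rfl
    · have h3 : max (t₀ + δ - t₀) (t₀ - (t₀ - δ)) = δ := by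
        rw [add_sub_cancel_left, sub_sub_cancel, max_self]
      change (L : ℝ) * max (t₀ + δ - t₀) (t₀ - (t₀ - δ)) ≤ _
      rw [h3, NNReal.coe_one, NNReal.coe_zero, sub_zero, hδ, mul_one_div, div_le_one (by positivity)]
      linarith
  obtain ⟨ψ, h1, h2⟩ := hP.exists_eq_forall_mem_Icc_hasDerivWithinAt₀
  exact ⟨δ, hδpos, ψ, by rw [h1, hU.apply_neg_apply], h2⟩

end Group

/-! ### The nonlinearity in coordinates -/

section Nonlinearity

variable {A : H →ₗ.[ℂ] H} {R : H →L[ℂ] H} {N : ℕ} {J : H → H}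

theorem NonlinearityHyp.exists_lipschitz (hJ : NonlinearityHyp A N J) {j : ℕ} (hj : j ≤ N)
    (M : ℝ) : ∃ K : ℝ≥0, ∀ u ∈ domPow A N, ∀ v ∈ domPow A N,
      (∀ i ≤ j, ‖powVal A i u‖ ≤ M) → (∀ i ≤ j, ‖powVal A i v‖ ≤ M) →
      ‖powVal A j (J u - J v)‖ ≤ K * ‖powVal A j (u - v)‖ := by
  obtain ⟨C, hC, hle⟩ := hJ.lipschitz j hj
  refine ⟨Real.toNNReal (C (fun _ => M, fun _ => M)), fun u hu v hv hMu hMv => ?_⟩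
  have hM : 0 ≤ M := (norm_nonneg _).trans (hMu 0 (Nat.zero_le _))
  have h1 : C (normVec A j u, normVec A j v) ≤ C (fun _ => M, fun _ => M) := by
    refine hC ⟨fun i => norm_nonneg _, fun i => norm_nonneg _⟩ ⟨fun i => hM, fun i => hM⟩
      ⟨fun i => hMu i (Nat.lt_succ_iff.1 i.2), fun i => hMv i (Nat.lt_succ_iff.1 i.2)⟩
  refine (hle u hu v hv).trans ?_
  gcongr
  exact h1.trans (Real.le_coe_toNNReal _)

/-- In the coordinates `y = (A - i) ^ N u` of `D(A ^ N)` the nonlinearity is locally Lipschitz. -/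
theorem NonlinearityHyp.exists_lift (hJ : NonlinearityHyp A N J)
    (hR : IsResolventAt A Complex.I R) :
    ∃ G : H → H, (∀ y, (R ^ N) (G y) = J ((R ^ N) y)) ∧
      ∀ M : ℝ, ∃ K : ℝ≥0, LipschitzOnWith K G (closedBall 0 M) := by
  have hmem : ∀ y, (R ^ N) y ∈ domPow A N := fun y => (hR.pow_mem_domPow_and N y).1
  have hex : ∀ y, ∃ w, (R ^ N) w = J ((R ^ N) y) := fun y =>
    hR.mem_domPow_iff.1 (hJ.mapsTo N le_rfl _ (hmem y))
  choose G hG using hex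
  refine ⟨G, hG, fun M => ?_⟩
  -- The Bézout identity recovers `w` from `u = R ^ N w` and `A ^ N u`, so the Lipschitz estimates
  -- for `j = 0` and `j = N` suffice.
  obtain ⟨P, Q, -, -, hPQ⟩ := exists_mul_pow_add_mul_shift_pow R N N
  obtain ⟨B, hB⟩ : ∃ B : ℝ, ∀ k ≤ N, ‖shift R ^ k * R ^ (N - k)‖ ≤ B := by
    refine ⟨∑ k ∈ Finset.range (N + 1), ‖shift R ^ k * R ^ (N - k)‖, fun k hk => ?_⟩
    exact Finset.single_le_sum (f := fun k => ‖shift R ^ k * R ^ (N - k)‖)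
      (fun _ _ => norm_nonneg _) (Finset.mem_range.2 (Nat.lt_succ_iff.2 hk))
  have hbd : ∀ y ∈ closedBall (0 : H) M, ∀ i ≤ N, ‖powVal A i ((R ^ N) y)‖ ≤ B * M := by
    intro y hy i hi
    rw [mem_closedBall, dist_zero_right] at hy
    rw [hR.powVal_pow hi]
    refine (ContinuousLinearMap.le_opNorm _ _).trans ?_
    exact mul_le_mul (hB i hi) hy (norm_nonneg _) ((norm_nonneg _).trans (hB i hi))
  obtain ⟨K₀, hK₀⟩ := hJ.exists_lipschitz (Nat.zero_le N) (B * M)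
  obtain ⟨K₁, hK₁⟩ := hJ.exists_lipschitz le_rfl (B * M)
  refine ⟨‖P‖₊ * (K₀ * ‖R ^ N‖₊) + ‖Q‖₊ * (K₁ * ‖shift R ^ N‖₊),
    LipschitzOnWith.of_dist_le_mul fun x hx y hy => ?_⟩
  have h0 := hK₀ _ (hmem x) _ (hmem y) (fun i hi => hbd x hx i (hi.trans (Nat.zero_le N)))
    (fun i hi => hbd y hy i (hi.trans (Nat.zero_le N)))
  have h1 := hK₁ _ (hmem x) _ (hmem y) (hbd x hx) (hbd y hy)
  rw [powVal_zero, powVal_zero, ← hG, ← hG, ← map_sub, ← map_sub] at h0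
  rw [← hG, ← hG, ← map_sub, ← map_sub, (hR.pow_mem_domPow_and N _).2,
    (hR.pow_mem_domPow_and N _).2] at h1
  have h2 : G x - G y = P ((R ^ N) (G x - G y)) + Q ((shift R ^ N) (G x - G y)) :=
    (DFunLike.congr_fun hPQ (G x - G y)).symm
  rw [dist_eq_norm, dist_eq_norm, h2]
  calc _ ≤ ‖P‖ * ‖(R ^ N) (G x - G y)‖ + ‖Q‖ * ‖(shift R ^ N) (G x - G y)‖ :=
        (norm_add_le _ _).trans
          (add_le_add (ContinuousLinearMap.le_opNorm _ _) (ContinuousLinearMap.le_opNorm _ _))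
    _ ≤ ‖P‖ * (K₀ * (‖R ^ N‖ * ‖x - y‖)) + ‖Q‖ * (K₁ * (‖shift R ^ N‖ * ‖x - y‖)) := by
        gcongr
        · exact h0.trans (by gcongr; exact ContinuousLinearMap.le_opNorm _ _)
        · exact h1.trans (by gcongr; exact ContinuousLinearMap.le_opNorm _ _)
    _ = _ := by push_cast; ring

end Nonlinearity

/-! ### Local existence, uniqueness, graph-norm continuity -/

section Solutions

variable {A : H →ₗ.[ℂ] H} {R : H →L[ℂ] H} {U : ℝ → H →L[ℂ] H} {N : ℕ} {J : H → H} {θ : ℂ}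

/-- `φ` solves `φ' = -i A φ + J(φ) + θ φ` on `S`. -/
def SolvesOn (A : H →ₗ.[ℂ] H) (J : H → H) (θ : ℂ) (S : Set ℝ) (φ : ℝ → H) : Prop :=
  ∀ t ∈ S, HasDerivWithinAt φ (-(Complex.I • powVal A 1 (φ t)) + J (φ t) + θ • φ t) S t

theorem SolvesOn.mono {S S' : Set ℝ} {φ : ℝ → H} (h : SolvesOn A J θ S φ) (hS : S' ⊆ S) :
    SolvesOn A J θ S' φ := fun t ht => (h t (hS ht)).mono hS

/-- Local existence, forward and backward in time, with continuity in the graph norm of `A ^ N`. -/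
theorem NonlinearityHyp.exists_local_solution [CompleteSpace H] (hJ : NonlinearityHyp A N J)
    (hN : 0 < N) (hR : IsResolventAt A Complex.I R) (hU : IsUnitaryGroup R U) (θ : ℂ) (t₀ : ℝ)
    {x₀ : H} (hx₀ : x₀ ∈ domPow A N) :
    ∃ δ > 0, ∃ y : ℝ → H, ContinuousOn y (Icc (t₀ - δ) (t₀ + δ)) ∧ (R ^ N) (y t₀) = x₀ ∧
      SolvesOn A J θ (Icc (t₀ - δ) (t₀ + δ)) fun t => (R ^ N) (y t) := by
  obtain ⟨G, hG, hGl⟩ := hJ.exists_lift hR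
  obtain ⟨y₀, rfl⟩ := hR.mem_domPow_iff.1 hx₀
  have hF : ∀ M : ℝ, ∃ K : ℝ≥0, LipschitzOnWith K (fun y => G y + θ • y) (closedBall 0 M) := by
    intro M
    obtain ⟨K, hK⟩ := hGl M
    exact ⟨K + ‖θ‖₊, hK.add ((lipschitzWith_smul θ).lipschitzOnWith)⟩
  obtain ⟨δ, hδ, ψ, h0, hψ⟩ := hU.exists_local_mild hF t₀ y₀
  refine ⟨δ, hδ, fun t => U t (ψ t), ?_, by simp only [h0], fun t ht => ?_⟩
  · exact continuousOn_apply_of_isometric hU.norm_eq hU.continuous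
      fun t ht => (hψ t ht).continuousWithinAt
  -- `ψ t` need not lie in `D(A)`; the group is differentiated along `R ^ N (ψ t)`, which does since
  -- `N > 0`.
  have hmem : (R ^ N) (ψ t) ∈ domPow A 1 :=
    domPow_anti hN (hR.pow_mem_domPow_and N (ψ t)).1
  have h1 : HasDerivWithinAt (fun s => (R ^ N) (ψ s))
      ((R ^ N) (U (-t) (G (U t (ψ t)) + θ • U t (ψ t)))) (Icc (t₀ - δ) (t₀ + δ)) t :=
    (((R ^ N).restrictScalars ℝ).hasFDerivAt.comp_hasDerivWithinAt t (hψ t ht))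
  have h2 := hU.hasDerivWithinAt_apply hR h1 hmem
  simp only [hU.apply_pow] at h2
  refine h2.congr_deriv ?_
  rw [map_sub, hU.apply_pow, hU.apply_neg_apply, map_smul, ← hU.powVal_one_apply hR t hmem,
    hU.apply_pow, map_add, hG, map_smul]
  abel

theorem NonlinearityHyp.eqOn_of_solvesOn (hJ : NonlinearityHyp A N J)
    (hN : 0 < N) (hR : IsResolventAt A Complex.I R) (hU : IsUnitaryGroup R U) {S : Set ℝ}
    [hS : S.OrdConnected] {f g : ℝ → H} (hf : SolvesOn A J θ S f) (hg : SolvesOn A J θ S g)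
    (hfm : ∀ t ∈ S, f t ∈ domPow A N) (hgm : ∀ t ∈ S, g t ∈ domPow A N) {t₀ : ℝ} (ht₀ : t₀ ∈ S)
    (h0 : f t₀ = g t₀) : EqOn f g S := by
  set v : ℝ → H → H := fun t x => U (-t) (J (U t x)) + θ • x with hv
  have hder : ∀ {h : ℝ → H}, SolvesOn A J θ S h → (∀ t ∈ S, h t ∈ domPow A N) → ∀ t ∈ S,
      HasDerivWithinAt (fun s => U (-s) (h s)) (v t (U (-t) (h t))) S t := by
    intro h hh hm t ht
    refine (hU.hasDerivWithinAt_neg_apply hR (hh t ht) (domPow_anti hN (hm t ht))).congr_deriv ?_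
    rw [hv]
    simp only [hU.apply_neg_apply, map_add, map_neg, map_smul]
    abel
  have hcont : ∀ {h : ℝ → H}, SolvesOn A J θ S h → ContinuousOn h S :=
    fun hh t ht => (hh t ht).continuousWithinAt
  have main : ∀ a b : ℝ, Icc a b ⊆ S → ∃ K : ℝ≥0, ∃ s : ℝ → Set H,
      (∀ t ∈ Icc a b, LipschitzOnWith K (v t) (s t)) ∧
      (∀ t ∈ Icc a b, U (-t) (f t) ∈ s t) ∧ ∀ t ∈ Icc a b, U (-t) (g t) ∈ s t := by
    intro a b hab
    obtain ⟨M₁, hM₁⟩ := isCompact_Icc.exists_bound_of_continuousOn ((hcont hf).mono hab)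
    obtain ⟨M₂, hM₂⟩ := isCompact_Icc.exists_bound_of_continuousOn ((hcont hg).mono hab)
    obtain ⟨K, hK⟩ := hJ.exists_lipschitz (Nat.zero_le N) (max M₁ M₂)
    -- The Lipschitz estimate holds only between points of `D(A ^ N)`, so the ODE uniqueness theorem
    -- is used on these sets, which need not be open.
    refine ⟨K + ‖θ‖₊, fun t => {x | U t x ∈ domPow A N ∧ ‖x‖ ≤ max M₁ M₂}, fun t _ => ?_,
      fun t ht => ?_, fun t ht => ?_⟩
    · refine LipschitzOnWith.add (LipschitzOnWith.of_dist_le_mul fun x hx y hy => ?_)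
        ((lipschitzWith_smul θ).lipschitzOnWith)
      have hb : ∀ {x : H}, ‖x‖ ≤ max M₁ M₂ → ∀ i ≤ 0, ‖powVal A i (U t x)‖ ≤ max M₁ M₂ := by
        intro x hx i hi
        rw [Nat.le_zero.1 hi, powVal_zero, hU.norm_eq]
        exact hx
      have h1 := hK _ hx.1 _ hy.1 (hb hx.2) (hb hy.2)
      rw [powVal_zero, powVal_zero, ← map_sub, hU.norm_eq] at h1
      rw [dist_eq_norm, dist_eq_norm, ← map_sub, hU.norm_eq]
      exact h1
    · refine ⟨?_, ?_⟩
      · rw [hU.apply_neg_apply]; exact hfm t (hab ht)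
      · rw [hU.norm_eq]; exact (hM₁ t ht).trans (le_max_left _ _)
    · refine ⟨?_, ?_⟩
      · rw [hU.apply_neg_apply]; exact hgm t (hab ht)
      · rw [hU.norm_eq]; exact (hM₂ t ht).trans (le_max_right _ _)
  have hinj : ∀ t, U (-t) (f t) = U (-t) (g t) → f t = g t := fun t h => by
    rw [← hU.apply_neg_apply t (f t), h, hU.apply_neg_apply]
  have hc' : ∀ {h : ℝ → H}, SolvesOn A J θ S h → (∀ t ∈ S, h t ∈ domPow A N) →
      ContinuousOn (fun s => U (-s) (h s)) S :=
    fun hh hm t ht => (hder hh hm t ht).continuousWithinAt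
  have hini : U (-t₀) (f t₀) = U (-t₀) (g t₀) := by rw [h0]
  intro t ht
  apply hinj
  rcases le_total t₀ t with h | h
  · have hsub : Icc t₀ t ⊆ S := hS.out ht₀ ht
    obtain ⟨K, s, h1, h2, h3⟩ := main t₀ t hsub
    have hr : ∀ {h : ℝ → H}, SolvesOn A J θ S h → (∀ t ∈ S, h t ∈ domPow A N) →
        ∀ r ∈ Ico t₀ t,
          HasDerivWithinAt (fun s => U (-s) (h s)) (v r (U (-r) (h r))) (Ici r) r := by
      intro h hh hm r hr
      refine (hder hh hm r (hsub (Ico_subset_Icc_self hr))).mono_of_mem_nhdsWithin ?_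
      exact mem_of_superset (Icc_mem_nhdsGE hr.2)
        ((Icc_subset_Icc_left hr.1).trans hsub)
    exact ODE_solution_unique_of_mem_Icc_right (v := v) (s := s) (K := K)
      (f := fun s => U (-s) (f s)) (g := fun s => U (-s) (g s))
      (fun r hr => h1 r (Ico_subset_Icc_self hr)) ((hc' hf hfm).mono hsub) (hr hf hfm)
      (fun r hr => h2 r (Ico_subset_Icc_self hr)) ((hc' hg hgm).mono hsub) (hr hg hgm)
      (fun r hr => h3 r (Ico_subset_Icc_self hr)) hini ⟨h, le_rfl⟩
  · have hsub : Icc t t₀ ⊆ S := hS.out ht ht₀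
    obtain ⟨K, s, h1, h2, h3⟩ := main t t₀ hsub
    have hr : ∀ {h : ℝ → H}, SolvesOn A J θ S h → (∀ t ∈ S, h t ∈ domPow A N) →
        ∀ r ∈ Ioc t t₀,
          HasDerivWithinAt (fun s => U (-s) (h s)) (v r (U (-r) (h r))) (Iic r) r := by
      intro h hh hm r hr
      refine (hder hh hm r (hsub (Ioc_subset_Icc_self hr))).mono_of_mem_nhdsWithin ?_
      exact mem_of_superset (Icc_mem_nhdsLE hr.1)
        ((Icc_subset_Icc_right hr.2).trans hsub)
    exact ODE_solution_unique_of_mem_Icc_left (v := v) (s := s) (K := K)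
      (f := fun s => U (-s) (f s)) (g := fun s => U (-s) (g s))
      (fun r hr => h1 r (Ioc_subset_Icc_self hr)) ((hc' hf hfm).mono hsub) (hr hf hfm)
      (fun r hr => h2 r (Ioc_subset_Icc_self hr)) ((hc' hg hgm).mono hsub) (hr hg hgm)
      (fun r hr => h3 r (Ioc_subset_Icc_self hr)) hini ⟨le_rfl, h⟩

/-- A solution on an interval with values in `D(A ^ N)` is automatically continuous in the graph
norm of `A ^ N`. -/
theorem NonlinearityHyp.exists_continuousOn_of_solvesOn [CompleteSpace H]
    (hJ : NonlinearityHyp A N J) (hN : 0 < N) (hR : IsResolventAt A Complex.I R)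
    (hU : IsUnitaryGroup R U) {S : Set ℝ} [hS : S.OrdConnected] {φ : ℝ → H}
    (hφ : SolvesOn A J θ S φ) (hm : ∀ t ∈ S, φ t ∈ domPow A N) :
    ∃ y : ℝ → H, ContinuousOn y S ∧ ∀ t ∈ S, φ t = (R ^ N) (y t) := by
  have hex : ∀ t, ∃ w, t ∈ S → φ t = (R ^ N) w := by
    intro t
    by_cases ht : t ∈ S
    · obtain ⟨w, hw⟩ := hR.mem_domPow_iff.1 (hm t ht)
      exact ⟨w, fun _ => hw.symm⟩
    · exact ⟨0, fun h => absurd h ht⟩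
  choose y hy using hex
  refine ⟨y, fun t₀ ht₀ => ?_, hy⟩
  -- Restart at `t₀` in both time directions: uniqueness and injectivity of `R ^ N` identify `y`
  -- with the continuous `z` near `t₀`.
  obtain ⟨δ, hδ, z, hz, hz0, hzs⟩ := hJ.exists_local_solution hN hR hU θ t₀ (hm t₀ ht₀)
  set S' := S ∩ Icc (t₀ - δ) (t₀ + δ) with hS'
  have hoc : S'.OrdConnected := hS.inter ordConnected_Icc
  have ht₀' : t₀ ∈ S' := ⟨ht₀, by constructor <;> linarith⟩
  have heq := hJ.eqOn_of_solvesOn hN hR hU (hφ.mono inter_subset_left)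
    (hzs.mono inter_subset_right) (fun t ht => hm t ht.1)
    (fun t _ => (hR.pow_mem_domPow_and N (z t)).1) ht₀' hz0.symm
  have hyz : EqOn y z S' := fun t ht => hR.pow_injective N ((hy t ht.1).symm.trans (heq ht))
  have h1 : ContinuousWithinAt y S' t₀ :=
    ((hz t₀ ht₀'.2).mono inter_subset_right).congr hyz (hyz ht₀')
  refine h1.mono_of_mem_nhdsWithin ?_
  exact inter_mem self_mem_nhdsWithin
    (mem_nhdsWithin_of_mem_nhds (Icc_mem_nhds (by linarith) (by linarith)))

end Solutions

/-! ### Lifting differentiability through `R` -/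

section Lifting

variable [CompleteSpace H] {R : H →L[ℂ] H} {T : ℝ}

/-- Differentiability lifts through an injective bounded operator if the derivative lifts to a
continuous function. -/
theorem hasDerivWithinAt_of_comp_injective (hR : Function.Injective R) {g g' : ℝ → H}
    (hd : ∀ t ∈ Ico 0 T, HasDerivWithinAt (fun s => R (g s)) (R (g' t)) (Ico 0 T) t)
    (hg' : ContinuousOn g' (Ico 0 T)) {t : ℝ} (ht : t ∈ Ico 0 T) :
    HasDerivWithinAt g (g' t) (Ico 0 T) t := by
  obtain ⟨b, htb, hbT⟩ := exists_between ht.2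
  have hb : 0 ≤ b := ht.1.trans htb.le
  have hsub : Icc 0 b ⊆ Ico 0 T := fun s hs => ⟨hs.1, hs.2.trans_lt hbT⟩
  -- Clamping time to `[0, b]` makes `g'` continuous on the whole line; its primitive is then
  -- compared with `g` after applying `R`.
  set k : ℝ → H := fun s => g' (max 0 (min s b)) with hk
  have hkc : Continuous k := hg'.comp_continuous (by fun_prop)
    fun s => hsub ⟨le_max_left _ _, max_le hb (min_le_right _ _)⟩
  have hke : ∀ s ∈ Icc 0 b, k s = g' s := fun s hs => by
    rw [hk]
    simp only [min_eq_left hs.2, max_eq_right hs.1]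
  set G : ℝ → H := fun s => g 0 + ∫ x in (0 : ℝ)..s, k x with hG
  have hGd : ∀ s, HasDerivAt G (k s) s := fun s =>
    (hkc.integral_hasStrictDerivAt 0 s).hasDerivAt.const_add _
  have hRG : ∀ s, HasDerivAt (fun s => R (G s)) (R (k s)) s := fun s =>
    (R.restrictScalars ℝ).hasFDerivAt.comp_hasDerivAt s (hGd s)
  have hnhds : ∀ {r : ℝ}, r < b → Icc 0 b ∈ 𝓝[Ico 0 T] r := fun {r} hr => by
    have h1 : Iio b ∈ 𝓝[Ico 0 T] r := mem_nhdsWithin_of_mem_nhds (Iio_mem_nhds hr)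
    filter_upwards [h1, self_mem_nhdsWithin] with s hs hs'
    exact ⟨hs'.1, le_of_lt hs⟩
  have hconst : ∀ s ∈ Icc 0 b, R (g s) - R (G s) = R (g 0) - R (G 0) := by
    refine constant_of_has_deriv_right_zero (fun s hs => ?_) fun s hs => ?_
    · exact ((hd s (hsub hs)).continuousWithinAt.mono hsub).sub
        (hRG s).continuousAt.continuousWithinAt
    · have hs' := Ico_subset_Icc_self hs
      have h1 : HasDerivWithinAt (fun s => R (g s)) (R (g' s)) (Ici s) s :=
        (hd s (hsub hs')).mono_of_mem_nhdsWithin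
          (mem_of_superset (Icc_mem_nhdsGE hs.2) ((Icc_subset_Icc_left hs.1).trans hsub))
      refine (h1.sub (hRG s).hasDerivWithinAt).congr_deriv ?_
      rw [hke s hs', sub_self]
  have heq : ∀ s ∈ Icc 0 b, g s = G s := fun s hs => by
    have h1 := hconst s hs
    have h2 : G 0 = g 0 := by
      rw [hG]
      simp only [intervalIntegral.integral_same, add_zero]
    rw [h2, sub_self, sub_eq_zero] at h1
    exact hR h1
  have htm : t ∈ Icc 0 b := ⟨ht.1, htb.le⟩
  have h3 : HasDerivWithinAt g (g' t) (Icc 0 b) t := by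
    rw [← hke t htm]
    exact (hGd t).hasDerivWithinAt.congr heq (heq t htm)
  exact h3.mono_of_mem_nhdsWithin (hnhds htb)

/-- This strips one resolvent: it makes `(A - i) φ` as often differentiable as `φ` when all
derivatives of `φ` factor continuously through `R`. -/
theorem contDiffOn_of_comp_injective (hR : Function.Injective R) {f : ℝ → H} {g : ℕ → ℝ → H}
    {j : ℕ} (hf : ContDiffOn ℝ j f (Ico 0 T))
    (hfg : ∀ k ≤ j, ∀ t ∈ Ico 0 T, iteratedDerivWithin k f (Ico 0 T) t = R (g k t))
    (hg : ∀ k ≤ j, ContinuousOn (g k) (Ico 0 T)) :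
    ContDiffOn ℝ j (g 0) (Ico 0 T) ∧
      ∀ k ≤ j, ∀ t ∈ Ico 0 T, iteratedDerivWithin k (g 0) (Ico 0 T) t = g k t := by
  have hu : UniqueDiffOn ℝ (Ico 0 T) := uniqueDiffOn_Ico 0 T
  have hder : ∀ k < j, ∀ t ∈ Ico 0 T, HasDerivWithinAt (g k) (g (k + 1) t) (Ico 0 T) t := by
    intro k hk t ht
    refine hasDerivWithinAt_of_comp_injective hR (fun s hs => ?_) (hg (k + 1) hk) ht
    have h1 := ((hf.differentiableOn_iteratedDerivWithin (Nat.cast_lt.2 hk) hu) s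
      hs).hasDerivWithinAt
    rw [← iteratedDerivWithin_succ, hfg (k + 1) hk s hs] at h1
    exact h1.congr (fun r hr => (hfg k hk.le r hr).symm) (hfg k hk.le s hs).symm
  have hit : ∀ k ≤ j, ∀ t ∈ Ico 0 T, iteratedDerivWithin k (g 0) (Ico 0 T) t = g k t := by
    intro k
    induction k with
    | zero => intro _ t _; rw [iteratedDerivWithin_zero]
    | succ k ih =>
      intro hk t ht
      rw [iteratedDerivWithin_succ, derivWithin_congr (ih (Nat.le_of_succ_le hk))
        (ih (Nat.le_of_succ_le hk) t ht)]
      exact (hder k hk t ht).derivWithin (hu t ht)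
  refine ⟨?_, hit⟩
  refine contDiffOn_of_continuousOn_differentiableOn_deriv (n := (j : ℕ∞)) (fun m hm => ?_)
    fun m hm => ?_
  · have hm' : m ≤ j := by exact_mod_cast hm
    exact (hg m hm').congr (hit m hm')
  · have hm' : m < j := by exact_mod_cast hm
    exact DifferentiableOn.congr (fun t ht => (hder m hm' t ht).differentiableWithinAt)
      (hit m hm'.le)

end Lifting

/-! ### Bootstrapping in time -/

section Regularity

variable {A : H →ₗ.[ℂ] H} {R : H →L[ℂ] H} {N : ℕ} {J : H → H} {θ : ℂ}

/-- A continuous curve whose image under `A ^ n` is continuous is continuous in the graph norm. -/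
theorem IsResolventAt.exists_continuousOn_lift (hR : IsResolventAt A Complex.I R) {n : ℕ}
    {S : Set ℝ} {f : ℝ → H} (hf : ContinuousOn f S) (hm : ∀ t ∈ S, f t ∈ domPow A n)
    (hp : ContinuousOn (fun t => powVal A n (f t)) S) :
    ∃ q : ℝ → H, ContinuousOn q S ∧ ∀ t ∈ S, f t = (R ^ n) (q t) := by
  obtain ⟨P, Q, -, -, hPQ⟩ := exists_mul_pow_add_mul_shift_pow R n n
  refine ⟨fun t => P (f t) + Q (powVal A n (f t)),
    (P.continuous.comp_continuousOn hf).add (Q.continuous.comp_continuousOn hp), fun t ht => ?_⟩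
  obtain ⟨w, hw⟩ := hR.mem_domPow_iff.1 (hm t ht)
  change f t = (R ^ n) (P (f t) + Q (powVal A n (f t)))
  rw [← hw, (hR.pow_mem_domPow_and n w).2]
  congr 1
  exact (DFunLike.congr_fun hPQ w).symm

/-- Bootstrapping: a solution that is continuous in the graph norm of `A ^ N` is `N` times
continuously differentiable, with derivatives that are continuous in the graph norms. -/
theorem PreservesDifferentiability.regularity [CompleteSpace H]
    (hJd : PreservesDifferentiability A N J) (hR : IsResolventAt A Complex.I R) {T : ℝ}
    (hT : 0 < T) {φ y : ℝ → H} (hφ : SolvesOn A J θ (Ico 0 T) φ)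
    (hyc : ContinuousOn y (Ico 0 T)) (hy : ∀ t ∈ Ico 0 T, φ t = (R ^ N) (y t)) {j : ℕ}
    (hj : j ≤ N) :
    ContDiffOn ℝ j φ (Ico 0 T) ∧ ∃ g : ℕ → ℝ → H, ∀ k ≤ j, ContinuousOn (g k) (Ico 0 T) ∧
      ∀ t ∈ Ico 0 T, iteratedDerivWithin k φ (Ico 0 T) t = (R ^ (N - k)) (g k t) := by
  have hu : UniqueDiffOn ℝ (Ico 0 T) := uniqueDiffOn_Ico 0 T
  induction j with
  | zero =>
    refine ⟨?_, fun _ => y, fun k hk => ?_⟩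
    · rw [Nat.cast_zero, contDiffOn_zero]
      exact fun t ht => (hφ t ht).continuousWithinAt
    · rw [Nat.le_zero.1 hk]
      exact ⟨hyc, fun t ht => by rw [iteratedDerivWithin_zero]; exact hy t ht⟩
  | succ j ih =>
    obtain ⟨hC, g, hg⟩ := ih (Nat.le_of_succ_le hj)
    have hjN : j < N := hj
    obtain ⟨hJC, hJm, hJp⟩ := hJd j hjN T hT φ
      (fun t ht => by rw [hy t ht]; exact (hR.pow_mem_domPow_and N _).1) hC (fun k hk => by
        obtain ⟨hgc, hge⟩ := hg k hk
        refine ⟨fun t ht => by rw [hge t ht]; exact (hR.pow_mem_domPow_and _ _).1, ?_⟩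
        refine ((shift R ^ (N - k)).continuous.comp_continuousOn hgc).congr fun t ht => ?_
        rw [hge t ht, (hR.pow_mem_domPow_and _ _).2]
        rfl)
    obtain ⟨q, hqc, hq⟩ := hR.exists_continuousOn_lift
      (hJC.continuousOn_iteratedDerivWithin le_rfl hu) hJm hJp
    have hsplit : ∀ k ≤ j, ∀ w : H, (R ^ (N - k)) w = R ((R ^ (N - k - 1)) w) := by
      intro k hk w
      have h1 : N - k = N - k - 1 + 1 := by omega
      rw [h1, pow_succ']
      rfl
    obtain ⟨hhC, hhi⟩ := contDiffOn_of_comp_injective (R := R) hR.injective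
      (g := fun k t => (R ^ (N - k - 1)) (g k t)) hC
      (fun k hk t ht => by rw [(hg k hk).2 t ht, hsplit k hk])
      fun k hk => (R ^ (N - k - 1)).continuous.comp_continuousOn (hg k hk).1
    set h : ℝ → H := fun t => (R ^ (N - 0 - 1)) (g 0 t) with hh
    have hφh : ∀ t ∈ Ico 0 T, φ t = R (h t) := fun t ht => by
      rw [hh, ← hsplit 0 (Nat.zero_le j), ← (hg 0 (Nat.zero_le j)).2 t ht, iteratedDerivWithin_zero]
    -- Here `h = (A - i) φ`, and `-i A φ = -i h + φ`. The right side is `j` times differentiable,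
    -- which gives `φ` one derivative more.
    have hder : EqOn (derivWithin φ (Ico 0 T))
        (fun t => (-Complex.I) • h t + ((1 + θ) • φ t + J (φ t))) (Ico 0 T) := by
      intro t ht
      rw [(hφ t ht).derivWithin (hu t ht)]
      have h1 : powVal A 1 (φ t) = shift R (h t) := by
        have := (hR.pow_mem_domPow_and 1 (h t)).2
        rw [pow_one, pow_one] at this
        rw [hφh t ht, this]
      simp only [h1, shift_apply, ← hφh t ht, smul_add, smul_smul, Complex.I_mul_I, add_smul,
        neg_smul, one_smul, neg_add, neg_neg]
      abel
    have hc1 : ContDiffOn ℝ j (fun t => (-Complex.I) • h t) (Ico 0 T) := hhC.const_smul _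
    have hc2 : ContDiffOn ℝ j (fun t => (1 + θ) • φ t) (Ico 0 T) := hC.const_smul _
    have hc3 : ContDiffOn ℝ j (fun t => (1 + θ) • φ t + J (φ t)) (Ico 0 T) := hc2.add hJC
    -- The new top coordinate comes from differentiating the equation `j` times and factoring out `R
    -- ^ (N - j - 1)`; `q` is the coordinate of the `j`-th derivative of `J ∘ φ`.
    refine ⟨?_, fun k => if k ≤ j then g k else
      fun t => (-Complex.I) • g j t + ((1 + θ) • R (g j t) + q t), fun k hk => ?_⟩
    · rw [Nat.cast_succ, contDiffOn_succ_iff_derivWithin hu]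
      refine ⟨fun t ht => (hφ t ht).differentiableWithinAt, fun hω => ?_,
        (hc1.add hc3).congr hder⟩
      exact absurd hω (WithTop.natCast_ne_top j)
    · by_cases hkj : k ≤ j
      · simp only [if_pos hkj]
        exact hg k hkj
      · obtain rfl : k = j + 1 := by omega
        simp only [if_neg hkj]
        have hgj := (hg j le_rfl).1
        refine ⟨(hgj.const_smul _).add (((R.continuous.comp_continuousOn hgj).const_smul _).add
          hqc), fun t ht => ?_⟩
        have hN : N - (j + 1) = N - j - 1 := by omega
        have hcomm : (R ^ (N - j)) (g j t) = (R ^ (N - j - 1)) (R (g j t)) := by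
          have h1 : N - j = N - j - 1 + 1 := by omega
          rw [h1, pow_succ]
          rfl
        rw [iteratedDerivWithin_succ', iteratedDerivWithin_congr hder ht,
          iteratedDerivWithin_fun_add ht hu (hc1 t ht) (hc3 t ht),
          iteratedDerivWithin_fun_add ht hu (hc2 t ht) (hJC t ht),
          iteratedDerivWithin_fun_const_smul ht hu _ (hhC t ht),
          iteratedDerivWithin_fun_const_smul ht hu _ (hC t ht),
          hhi j le_rfl t ht, (hg j le_rfl).2 t ht, hq t ht, hcomm, hN]
        simp only [map_add, map_smul]

end Regularity

end SemilinearEvolution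

/-! ### Conclusion -/

theorem theorem2p6 {H : Type*} [NormedAddCommGroup H] [InnerProductSpace ℂ H] [CompleteSpace H]
    (A : H →ₗ.[ℂ] H) (hA : IsSelfAdjoint A) (N : ℕ) (hN : 0 < N) (J : H → H)
    (hJ : SemilinearEvolution.NonlinearityHyp A N J)
    (hJd : SemilinearEvolution.PreservesDifferentiability A N J)
    {E : Type*} [AddCommGroup E] [Module ℂ E] (Θ : E → ℂ) (ζ η : E) (z : ℂ)
    (φ₀ : H) (hφ₀ : φ₀ ∈ SemilinearEvolution.domPow A N) :
    (∃ T > (0 : ℝ), ∃ φ : ℝ → H,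
      SemilinearEvolution.IsStrongSolution A N J (Θ (ζ + z • η)) φ₀ T φ) ∧
    ∀ T > (0 : ℝ), ∀ φ : ℝ → H,
      SemilinearEvolution.IsStrongSolution A N J (Θ (ζ + z • η)) φ₀ T φ →
      (∀ ψ : ℝ → H, SemilinearEvolution.IsStrongSolution A N J (Θ (ζ + z • η)) φ₀ T ψ →
        Set.EqOn ψ φ (Set.Ico 0 T)) ∧
      ContDiffOn ℝ N φ (Set.Ico 0 T) ∧
      ∀ j ≤ N, ∀ t ∈ Set.Ico 0 T,
        iteratedDerivWithin j φ (Set.Ico 0 T) t ∈ SemilinearEvolution.domPow A (N - j) := by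
  obtain ⟨R, hR⟩ := SemilinearEvolution.exists_isResolventAt hA (c := Complex.I) (by simp)
  obtain ⟨U, hU⟩ := hR.exists_isUnitaryGroup hA
  refine ⟨?_, fun T hT φ hφ => ⟨fun ψ hψ => ?_, ?_⟩⟩
  · obtain ⟨δ, hδ, y, -, h0, hy⟩ :=
      hJ.exists_local_solution hN hR hU (Θ (ζ + z • η)) 0 hφ₀
    refine ⟨δ, hδ, fun t => (R ^ N) (y t), fun t _ => (hR.pow_mem_domPow_and N _).1, h0, ?_⟩
    exact hy.mono fun t ht => ⟨by linarith [ht.1], by linarith [ht.2]⟩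
  · exact hJ.eqOn_of_solvesOn hN hR hU hψ.hasDeriv hφ.hasDeriv hψ.mem hφ.mem
      (t₀ := 0) ⟨le_rfl, hT⟩ (hψ.init.trans hφ.init.symm)
  · obtain ⟨y, hyc, hy⟩ := hJ.exists_continuousOn_of_solvesOn hN hR hU hφ.hasDeriv hφ.mem
    obtain ⟨hC, g, hg⟩ := hJd.regularity hR hT hφ.hasDeriv hyc hy le_rfl
    refine ⟨hC, fun j hj t ht => ?_⟩
    rw [(hg j hj).2 t ht]
    exact (hR.pow_mem_domPow_and _ _).1
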